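/- **Setting.** A tree-alphabet is a finite list of letters $a_1,\dots,a_k$ ($k\ge 1$) with a map $f$ to $\{-1,0,1,2,\dots\}$ such that $f(a_1)=-1$ and $f(a_1)\le\dots\le f(a_k)$. The trees considered are the rooted planar trees whose nodes are labelled by letters, a node labelled $a$ having $f(a)+1$ ordered sons; the type of a tree is the tuple $\boldsymbol n=(n_1,\dots,n_k)$ where $n_i$ is its number of nodes labelled $a_i$. A tuple $\boldsymbol n\in\mathbb N^k$ is valid if $\sum_i n_i f(a_i)=-1$; put $|\boldsymbol n|=\sum_i n_i$, and for $\boldsymbol n\ne 0$ let $D_{\boldsymbol n}$ be the distribution $\mathrm{Prob}(a_i)=n_i/|\boldsymbol n|$. A sampler is any algorithm that reads independent fair bits, i.e. a possibly infinite binary decision tree; its cost is the expected number of bits it reads. It is uniform on a set if it stops almost surely, its output is in the set, and all elements of the set are output with equal probability. **Algorithm.** Let $\mathrm{Distrib}$ be a procedure that samples from $D_{\boldsymbol n}$ for every $\boldsymbol n\neq 0$. On a valid input $\boldsymbol n$: repeat $|\boldsymbol n|$ times: draw a letter $a_i$ by $\mathrm{Distrib}(\boldsymbol n)$, append it to the word,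 replace $\boldsymbol n$ by $\boldsymbol n-\boldsymbol e_i$. If $w$ is the word so obtained and $\ell\in\{1,\dots,|w|\}$ is the smallest index minimizing $f(w_1)+\dots+f(w_\ell)$, return the tree whose prefix code is $w_{\ell+1}\cdots w_{|w|}w_1\cdots w_\ell$. **Theorem.** Fix a tree-alphabet. Let $\mathrm{Distrib}$ be either the Knuth–Yao sampler (whose decision tree has, for each $i$ and $c\ge0$, exactly one leaf labelled $a_i$ at level $c$ if the digit of weight $2^{-c}$ in the binary expansion of $n_i/|\boldsymbol n|$ is $1$ — the finite expansion if this number is dyadic — and no such leaf otherwise), or dichotomic sampling (cut $[0,|\boldsymbol n|]$ into consecutive parts of lengths $n_1,\dots,n_k$, start from the indices $i=1$, $j=k$, and as long as $i\neq j$ replace the current interval by its right or left half according to a random bit, after a right half increasing $i$ to the first part that ends strictly to the right of the left end of the interval, after a left half decreasing $j$ to the last part that begins strictly to the left of its right end; return $a_i$ when $i=j$). Let $B(\boldsymbol n)$ be the cost of the algorithm above on input $\boldsymbol n$. Then: 1. For every valid $\boldsymbol n$ the algorithm is a uniform sampler of the trees of type $\boldsymbol n$. 2. $B(\boldsymbol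 n)\le(2+\log_2 k)\,|\boldsymbol n|$ for every valid $\boldsymbol n$. 3. Its random-bit complexity is optimal up to a multiplicative constant: if there are two distinct trees of the same type, there are constants $C$ and $m_0$, depending only on the tree-alphabet, such that for all $m\ge m_0$ and every family $S=(S_{\boldsymbol n})$ of uniform samplers of the trees of type $\boldsymbol n$ ($\boldsymbol n$ valid), $$\max_{\boldsymbol n\text{ valid},\,|\boldsymbol n|=m}B(\boldsymbol n)\ \le\ C\,\sup_{\boldsymbol n\text{ valid},\,|\boldsymbol n|=m}\mathrm{cost}(S_{\boldsymbol n}),$$ where both sides are read as $0$ if no valid tuple has total $m$. 4. It is also optimal up to a multiplicative constant for each given type with non-degenerate proportions: for every $\delta>0$ there are $C$ and $m_0$, depending only on $\delta$ and the tree-alphabet, such that $B(\boldsymbol n)\le C\,\mathrm{cost}(t)$ for every valid $\boldsymbol n$ with $|\boldsymbol n|\ge m_0$ in which at least two of the $n_i$ are $\ge\delta|\boldsymbol n|$, and every uniform sampler $t$ of the trees of type $\boldsymbol n$. Moreover, with the Knuth–Yao sampler the draws of the letters are exactly optimal: for every valid $\boldsymbol n$ the cost of the algorithm is then at most its cost with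 any other procedure $\mathrm{Distrib}$ that samples exactly from all the distributions $D_{\boldsymbol n}$, $\boldsymbol n\ne0$. -/

import Mathlib

open scoped ENNReal NNReal

/-! ### Algorithms that read fair random bits -/

/-- An algorithm reading independent fair bits, as a (possibly infinite) binary decision tree
(a DDG-tree): `t s = none` means that after reading exactly the bits `s` the algorithm asks for
another bit, and `t s = some a` means that it stops with output `a`. Values of `t` strictly below
a stopping node are irrelevant. -/
abbrev BitSampler (α : Type) : Type := List Bool → Option α

namespace BitSampler

variable {α β : Type}

/-- `s` is a node at which the algorithm stops, for the first time, with output `a`. -/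
def Leaf (t : BitSampler α) (a : α) (s : List Bool) : Prop :=
  t s = some a ∧ ∀ p : List Bool, p <+: s → p ≠ s → t p = none

/-- `s` is a node which the algorithm may reach and at which it reads one more bit. -/
def Internal (t : BitSampler α) (s : List Bool) : Prop :=
  ∀ p : List Bool, p <+: s → t p = none

/-- The probability that the algorithm stops with output `a`. -/
noncomputable def prob (t : BitSampler α) (a : α) : ℝ≥0∞ :=
  ∑' s : {s : List Bool // t.Leaf a s}, (2⁻¹ : ℝ≥0∞) ^ s.1.length

/-- The expected number of random bits read: a bit is read at each internal node that is visited,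
and the node `s` is visited with probability `2 ^ (-|s|)`. -/
noncomputable def cost (t : BitSampler α) : ℝ≥0∞ :=
  ∑' s : {s : List Bool // t.Internal s}, (2⁻¹ : ℝ≥0∞) ^ s.1.length

/-- Use no bit; stop at once with output `a` if `o = some a`, run forever if `o = none`. -/
def ofOption (o : Option α) : BitSampler α := fun _ => o

/-- Run `t`; when it stops with output `a`, run `g a` on the bits that follow. -/
def bind (t : BitSampler α) (g : α → BitSampler β) : BitSampler β
  | [] =>
    match t [] with
    | some a => g a []
    | none => none
  | b :: s =>
    match t [] with
    | some a => g a (b :: s)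
    | none => bind (fun r => t (b :: r)) g s

/-- `t` stops almost surely, its output lies in `S`, and any two elements of `S` are output with
the same probability. -/
def IsUniformOn (t : BitSampler α) (S : Set α) : Prop :=
  (∑' a, t.prob a = 1) ∧ (∀ a, a ∉ S → t.prob a = 0) ∧
    ∀ a ∈ S, ∀ b ∈ S, t.prob a = t.prob b

end BitSampler

/-! ### Two samplers for the distribution `D_n`, where `D_n(i) = n_i / ∑ n_j` -/

section Letters

variable {k : ℕ}

/-- The letters `i` such that the binary digit of weight `2 ^ (-c)` of `n_i / ∑ n_j` is `1`,
in increasing order. -/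
def kyLabels (n : Fin k → ℕ) (c : ℕ) : List (Fin k) :=
  (List.finRange k).filter fun i => (2 ^ c * n i / ∑ j, n j) % 2 = 1

/-- The Knuth-Yao tree below the node of index `d` among the nodes of level `c`: the first nodes of
level `c` are leaves, labelled by `kyLabels n c`; each of the others has two sons. -/
def kyFrom (n : Fin k → ℕ) (c d : ℕ) : BitSampler (Fin k)
  | [] => (kyLabels n c)[d]?
  | b :: s =>
    if d < (kyLabels n c).length then (kyLabels n c)[d]?
    else kyFrom n (c + 1) (2 * (d - (kyLabels n c).length) + b.toNat) s

/-- The Knuth-Yao sampler for `D_n`: its DDG-tree has, for each `c`, one leaf labelled `i` at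
level `c` if the digit of weight `2 ^ (-c)` of `n_i / ∑ n_j` is `1`, and none if it is `0`. -/
def knuthYao (n : Fin k → ℕ) : BitSampler (Fin k) := kyFrom n 0 0

/-- `n_0 + ⋯ + n_{l-1}`. The `i`-th part of `[0, ∑ n_j]` is the interval from `partialSum n i`
to `partialSum n (i + 1)`. -/
def partialSum (n : Fin k → ℕ) (l : ℕ) : ℕ := ∑ j : Fin k, if (j : ℕ) < l then n j else 0

/-- Increase the index until its part ends to the right of `lo`. -/
def moveUp (n : Fin k → ℕ) (lo : ℚ) (i : Fin k) : Fin k :=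
  ((List.finRange k).find? fun l => i ≤ l ∧ lo < partialSum n (l + 1)).getD i

/-- Decrease the index until its part begins to the left of `hi`. -/
def moveDown (n : Fin k → ℕ) (hi : ℚ) (j : Fin k) : Fin k :=
  ((List.finRange k).reverse.find? fun l => l ≤ j ∧ (partialSum n l : ℚ) < hi).getD j

/-- The loop of dichotomic sampling: while `i ≠ j`, halve the interval `[lo, hi]`, keeping its right
half if the bit is `1` and its left half if it is `0`, and update the indices `i ≤ j` of the parts
that the interval may still meet. -/
def dichotomicLoop (n : Fin k → ℕ) (i j : Fin k) (lo hi : ℚ) : BitSampler (Fin k)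
  | [] => if i = j then some i else none
  | b :: s =>
    if i = j then some i
    else if b then dichotomicLoop n (moveUp n ((lo + hi) / 2) i) j ((lo + hi) / 2) hi s
    else dichotomicLoop n i (moveDown n ((lo + hi) / 2) j) lo ((lo + hi) / 2) s

/-- Dichotomic sampling for `D_n`. -/
def dichotomic [NeZero k] (n : Fin k → ℕ) : BitSampler (Fin k) :=
  dichotomicLoop n 0 ⊤ 0 ((∑ j, n j : ℕ) : ℚ)

/-- `D n` samples exactly from `D_n`, for every nonzero tuple `n`. -/
def IsLetterSampler (D : (Fin k → ℕ) → BitSampler (Fin k)) : Prop :=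
  ∀ n : Fin k → ℕ, n ≠ 0 → ∀ i, (D n).prob i = (n i : ℝ≥0∞) / ((∑ j, n j : ℕ) : ℝ≥0∞)

/-- Draw a word of length `m` letter by letter: draw a letter `i` by `D n`, then go on with the
tuple `n - e_i`. -/
def drawWord (D : (Fin k → ℕ) → BitSampler (Fin k)) :
    ℕ → (Fin k → ℕ) → BitSampler (List (Fin k))
  | 0, _ => BitSampler.ofOption (some [])
  | m + 1, n => BitSampler.bind (D n) fun i =>
      BitSampler.bind (drawWord D m (n - Pi.single i 1)) fun w =>
        BitSampler.ofOption (some (i :: w))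

end Letters

/-! ### Tree-alphabets, trees, and the tree sampler -/

/-- A tree-alphabet with the `k ≥ 1` letters `0, …, k - 1`. -/
structure TreeAlphabet (k : ℕ) [NeZero k] where
  f : Fin k → ℤ
  neg_one_le : ∀ i, -1 ≤ f i
  first : f 0 = -1
  mono : Monotone f

namespace TreeAlphabet

variable {k : ℕ} [NeZero k] (A : TreeAlphabet k)

/-- The number `f(a) + 1` of sons of a node labelled `a`. -/
def arity (a : Fin k) : ℕ := (A.f a + 1).toNat

/-- Rooted planar trees whose nodes are labelled by letters, a node labelled `a` having
`f(a) + 1` linearly ordered sons. -/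
abbrev Tree : Type := WType fun a : Fin k => Fin (A.arity a)

/-- The number of nodes of a tree that are labelled `i`. -/
def count (i : Fin k) : A.Tree → ℕ
  | WType.mk a c => (if a = i then 1 else 0) + ∑ j, count i (c j)

/-- The trees with exactly `n i` nodes labelled `i`, for every letter `i`. -/
def treesOfType (n : Fin k → ℕ) : Set A.Tree := {T | ∀ i, A.count i T = n i}

/-- The tuple `n` is `f`-valid. -/
def Valid (n : Fin k → ℕ) : Prop := ∑ i, (n i : ℤ) * A.f i = -1

/-- `f(w_1) + ⋯ + f(w_l)`. -/
def height (w : List (Fin k)) (l : ℕ) : ℤ := ((w.take l).map A.f).sum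

/-- The smallest `l` in `{1, …, |w|}` that minimizes `f(w_1) + ⋯ + f(w_l)`. -/
def cutIndex (w : List (Fin k)) : ℕ :=
  ((List.range' 1 w.length).find? fun l =>
    (List.range' 1 w.length).all fun l' => A.height w l ≤ A.height w l').getD 0

/-- The circular permutation `w_{l+1} ⋯ w_n w_1 ⋯ w_l` of `w` at its cut index `l`. -/
def toLukasiewicz (w : List (Fin k)) : List (Fin k) := w.rotate (A.cutIndex w)

/-- The list of trees of which `w` is the prefix (depth-first, left to right) code: the first
`f(a) + 1` trees coded by `w` become the sons of a root labelled `a` in the forest of code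
`a w`. (The value is `[]` if there are not enough trees.) -/
def forest : List (Fin k) → List A.Tree
  | [] => []
  | a :: w =>
    if h : A.arity a ≤ (forest w).length then
      WType.mk a (fun j => (forest w)[j.1]'(lt_of_lt_of_le j.2 h)) :: (forest w).drop (A.arity a)
    else []

/-- The tree whose prefix code is `w`, if there is one. -/
def toTree (w : List (Fin k)) : Option A.Tree :=
  match A.forest w with
  | [T] => some T
  | _ => none

/-- The tree sampler: draw a valid word letter by letter by means of `D`, rotate it into a
Lukasiewicz word, and convert that word into a tree. -/
def treeSampler (D : (Fin k → ℕ) → BitSampler (Fin k)) (n : Fin k → ℕ) : BitSampler A.Tree :=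
  BitSampler.bind (drawWord D (∑ i, n i) n) fun w =>
    BitSampler.ofOption (A.toTree (A.toLukasiewicz w))

/-- `S n` samples uniformly the trees of type `n`, for every valid tuple `n`. -/
def IsTreeSampler (S : (Fin k → ℕ) → BitSampler A.Tree) : Prop :=
  ∀ n, A.Valid n → (S n).IsUniformOn (A.treesOfType n)

/-- The random-bit complexity of a tree sampler at size `m`: the largest expected number of bits
over the valid tuples of total `m`. -/
noncomputable def complexity (S : (Fin k → ℕ) → BitSampler A.Tree) (m : ℕ) : ℝ≥0∞ :=
  ⨆ (n : Fin k → ℕ) (_ : A.Valid n ∧ ∑ i, n i = m), (S n).cost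

end TreeAlphabet

/-! Uniformity. With exact letter draws, the probability of a word of type `n` is a product whose
numerators multiply to `∏ n_i!` and whose denominators multiply to `|n|!`, whatever the order of the
letters (`prob_drawWord`). The cycle lemma does the rest: prefix codes of trees are the words of
weight -1 all of whose nonempty suffixes have negative weight, a code has `|n|` distinct rotations,
and the algorithm sends exactly these to its tree (`toLukasiewicz_eq_code_iff`,
`rotate_code_injOn`). So all trees of type `n` receive the same mass.

Upper bound. Rotation and decoding read no bit, so only the draws cost. The cost of a decision tree
is the sum over `c` of `2^(-c)` times its number of internal nodes on level `c`; if this number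
never exceeds `k`, the cost is at most `2 + log₂ k` (`cost_le_of_runCount_le`). In dichotomic
sampling the two halves of an interval share at most one candidate letter, which bounds the internal
nodes of each level (`runCount_dichotomicLoop_le`). An exact sampler can have stopped on `i` for at
most `⌊2^c n_i/|n|⌋` strings of length `c`; Knuth-Yao attains this for all `i` and `c` at once,
hence is cheapest level by level (`cost_knuthYao_le`) and inherits the bound.

Lower bound. A uniform sampler on at least `2^d` objects has no leaf above level `d`, so it reads at
least `d` bits (`IsUniformOn.le_cost`). Two letters occurring `r` times give `2^r` words, hence at
least `2^r/|n|` trees, and a cost of at least `r - log₂|n| - 1`, which is linear when both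
proportions are bounded below (`exists_mul_le_cost`). For the worst case, any valid type can be
turned into a valid one of the same total with two frequent letters, unless types determine trees
(`exists_balanced`). -/

/-! ### Sums over finite bit strings -/

theorem ENNReal.tsum_iSup_of_monotone {α : Type*} (F : α → ℕ → ℝ≥0∞) (hF : ∀ a, Monotone (F a)) :
    ∑' a, ⨆ c, F a c = ⨆ c, ∑' a, F a c := by
  simp_rw [ENNReal.tsum_eq_iSup_sum]
  rw [iSup_comm]
  refine iSup_congr fun s => ?_
  exact ENNReal.finsetSum_iSup_of_monotone hF

theorem tsum_list_bool (g : List Bool → ℝ≥0∞) :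
    ∑' s, g s = g [] + (∑' s, g (false :: s) + ∑' s, g (true :: s)) := by
  let e : Unit ⊕ (List Bool ⊕ List Bool) ≃ List Bool :=
    { toFun := Sum.elim (fun _ => []) (Sum.elim (List.cons false) (List.cons true))
      invFun := fun
        | [] => .inl ()
        | false :: s => .inr (.inl s)
        | true :: s => .inr (.inr s)
      left_inv := by rintro (_ | _ | _) <;> rfl
      right_inv := by rintro (_ | ⟨_ | _, _⟩) <;> rfl }
  rw [← e.tsum_eq g, Summable.tsum_sum ENNReal.summable ENNReal.summable,
    Summable.tsum_sum ENNReal.summable ENNReal.summable]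
  simp [e]

theorem tsum_list_bool_length (g : List Bool → ℝ≥0∞) :
    ∑' s, g s = ∑' c : ℕ, ∑' s, if s.length = c then g s else 0 := by
  rw [ENNReal.tsum_comm]
  refine tsum_congr fun s => ?_
  simp_rw [eq_comm (a := s.length)]
  rw [tsum_ite_eq]

theorem tsum_list_bool_length_zero (g : List Bool → ℝ≥0∞) :
    (∑' s, if s.length = 0 then g s else 0) = g [] := by
  rw [tsum_list_bool]; simp

theorem tsum_list_bool_length_succ (g : List Bool → ℝ≥0∞) (c : ℕ) :
    (∑' s, if s.length = c + 1 then g s else 0) =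
      (∑' s, if s.length = c then g (false :: s) else 0) +
        ∑' s, if s.length = c then g (true :: s) else 0 := by
  rw [tsum_list_bool]; simp

/-! ### Decision trees: stopping probabilities, cost and sequential composition -/

namespace BitSampler

variable {α β : Type}

/-- The sampler that is left to run once the bit `b` has been read. -/
def after (t : BitSampler α) (b : Bool) : BitSampler α := fun s => t (b :: s)

theorem leaf_nil {t : BitSampler α} {a : α} : t.Leaf a [] ↔ t [] = some a := by
  constructor
  · exact fun h => h.1
  · exact fun h => ⟨h, fun p hp hne => absurd (List.prefix_nil.1 hp) hne⟩

theorem leaf_cons {t : BitSampler α} {a : α} {b : Bool} {s : List Bool} :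
    t.Leaf a (b :: s) ↔ t [] = none ∧ (t.after b).Leaf a s := by
  constructor
  · rintro ⟨h1, h2⟩
    refine ⟨h2 [] List.nil_prefix (by simp), h1, fun p hp hne => h2 (b :: p) ?_ (by simpa using hne)⟩
    simpa using hp
  · rintro ⟨h0, h1, h2⟩
    refine ⟨h1, fun p hp hne => ?_⟩
    rcases p with _ | ⟨b', p⟩
    · exact h0
    · obtain ⟨rfl, hp'⟩ := List.cons_prefix_cons.1 hp
      exact h2 p hp' (by simpa using hne)

theorem internal_nil {t : BitSampler α} : t.Internal [] ↔ t [] = none := by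
  constructor
  · exact fun h => h [] List.nil_prefix
  · intro h p hp
    rw [List.prefix_nil.1 hp, h]

theorem internal_cons {t : BitSampler α} {b : Bool} {s : List Bool} :
    t.Internal (b :: s) ↔ t [] = none ∧ (t.after b).Internal s := by
  constructor
  · intro h
    exact ⟨h [] List.nil_prefix, fun p hp => h (b :: p) (by simpa using hp)⟩
  · rintro ⟨h0, h1⟩ p hp
    rcases p with _ | ⟨b', p⟩
    · exact h0
    · obtain ⟨rfl, hp'⟩ := List.cons_prefix_cons.1 hp
      exact h1 p hp'

open scoped Classical in
/-- The number of bit strings of length `c` on which the algorithm has stopped with output `a`. -/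
noncomputable def stopCount : ℕ → BitSampler α → α → ℕ
  | 0, t, a => if t [] = some a then 1 else 0
  | c + 1, t, a =>
    match t [] with
    | some b => if b = a then 2 ^ (c + 1) else 0
    | none => stopCount c (t.after false) a + stopCount c (t.after true) a

/-- The number of bit strings of length `c` on which the algorithm has not yet stopped. -/
def runCount : ℕ → BitSampler α → ℕ
  | 0, t => if (t []).isNone then 1 else 0
  | c + 1, t =>
    if (t []).isNone then runCount c (t.after false) + runCount c (t.after true) else 0

open scoped Classical in
theorem stopCount_of_some {t : BitSampler α} {b : α} (h : t [] = some b) (c : ℕ) (a : α) :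
    stopCount c t a = if b = a then 2 ^ c else 0 := by
  cases c <;> simp [stopCount, h]

theorem stopCount_zero_of_none {t : BitSampler α} (h : t [] = none) (a : α) :
    stopCount 0 t a = 0 := by
  simp [stopCount, h]

theorem stopCount_succ_of_none {t : BitSampler α} (h : t [] = none) (c : ℕ) (a : α) :
    stopCount (c + 1) t a = stopCount c (t.after false) a + stopCount c (t.after true) a := by
  simp [stopCount, h]

theorem runCount_of_some {t : BitSampler α} {b : α} (h : t [] = some b) (c : ℕ) :
    runCount c t = 0 := by
  cases c <;> simp [runCount, h]

theorem runCount_zero_of_none {t : BitSampler α} (h : t [] = none) : runCount 0 t = 1 := by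
  simp [runCount, h]

theorem runCount_succ_of_none {t : BitSampler α} (h : t [] = none) (c : ℕ) :
    runCount (c + 1) t = runCount c (t.after false) + runCount c (t.after true) := by
  simp [runCount, h]

theorem sum_stopCount_add_runCount [Fintype α] (c : ℕ) (t : BitSampler α) :
    ∑ a, stopCount c t a + runCount c t = 2 ^ c := by
  classical
  induction c generalizing t with
  | zero =>
    rcases h : t [] with _ | b
    · simp [stopCount_zero_of_none h, runCount_zero_of_none h]
    · simp [stopCount_of_some h, runCount_of_some h]
  | succ c ih =>
    rcases h : t [] with _ | b
    · simp only [stopCount_succ_of_none h, runCount_succ_of_none h, Finset.sum_add_distrib]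
      have h1 := ih (t.after false)
      have h2 := ih (t.after true)
      rw [pow_succ]; omega
    · simp [stopCount_of_some h, runCount_of_some h]

theorem runCount_le_two_pow (c : ℕ) (t : BitSampler α) : runCount c t ≤ 2 ^ c := by
  induction c generalizing t with
  | zero =>
    rcases h : t [] with _ | b
    · simp [runCount_zero_of_none h]
    · simp [runCount_of_some h]
  | succ c ih =>
    rcases h : t [] with _ | b
    · rw [runCount_succ_of_none h, pow_succ]
      have h1 := ih (t.after false)
      have h2 := ih (t.after true)
      omega
    · simp [runCount_of_some h]

/-- The probability that the algorithm stops with output `a` after reading at most `c` bits. -/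
noncomputable def probUpTo (c : ℕ) (t : BitSampler α) (a : α) : ℝ≥0∞ :=
  stopCount c t a * 2⁻¹ ^ c

theorem two_pow_mul_inv_two_pow (c : ℕ) : (2 : ℝ≥0∞) ^ c * 2⁻¹ ^ c = 1 := by
  rw [← mul_pow, ENNReal.mul_inv_cancel (by norm_num) (by norm_num), one_pow]

open scoped Classical in
theorem probUpTo_of_some {t : BitSampler α} {b : α} (h : t [] = some b) (c : ℕ) (a : α) :
    probUpTo c t a = if b = a then 1 else 0 := by
  rw [probUpTo, stopCount_of_some h]
  split_ifs
  · push_cast; exact two_pow_mul_inv_two_pow c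
  · simp

theorem probUpTo_zero_of_none {t : BitSampler α} (h : t [] = none) (a : α) :
    probUpTo 0 t a = 0 := by
  simp [probUpTo, stopCount_zero_of_none h]

theorem probUpTo_succ_of_none {t : BitSampler α} (h : t [] = none) (c : ℕ) (a : α) :
    probUpTo (c + 1) t a =
      2⁻¹ * (probUpTo c (t.after false) a + probUpTo c (t.after true) a) := by
  simp only [probUpTo, stopCount_succ_of_none h, pow_succ]
  push_cast; ring

open scoped Classical in
theorem prob_eq_tsum_ite (t : BitSampler α) (a : α) :
    t.prob a = ∑' s : List Bool, if t.Leaf a s then (2⁻¹ : ℝ≥0∞) ^ s.length else 0 := by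
  rw [prob]
  exact tsum_subtype {s | t.Leaf a s} (fun s : List Bool => (2⁻¹ : ℝ≥0∞) ^ s.length)

open scoped Classical in
theorem cost_eq_tsum_ite (t : BitSampler α) :
    t.cost = ∑' s : List Bool, if t.Internal s then (2⁻¹ : ℝ≥0∞) ^ s.length else 0 := by
  rw [cost]
  exact tsum_subtype {s | t.Internal s} (fun s : List Bool => (2⁻¹ : ℝ≥0∞) ^ s.length)

open scoped Classical in
theorem tsum_internal_length (c : ℕ) (t : BitSampler α) :
    (∑' s : List Bool, if s.length = c then
      (if t.Internal s then (2⁻¹ : ℝ≥0∞) ^ s.length else 0) else 0) = runCount c t * 2⁻¹ ^ c := by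
  induction c generalizing t with
  | zero =>
    rw [tsum_list_bool_length_zero, internal_nil]
    rcases h : t [] with _ | b
    · simp [runCount_zero_of_none h]
    · simp [runCount_of_some h]
  | succ c ih =>
    rw [tsum_list_bool_length_succ]
    simp only [internal_cons]
    rcases h : t [] with _ | b
    · have key : ∀ b, (∑' s : List Bool, if s.length = c then
          (if (t.after b).Internal s then (2⁻¹ : ℝ≥0∞) ^ (b :: s).length else 0) else 0) =
          2⁻¹ * (runCount c (t.after b) * 2⁻¹ ^ c) := by
        intro b
        rw [← ih (t.after b), ← ENNReal.tsum_mul_left]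
        refine tsum_congr fun s => ?_
        split_ifs <;> simp [pow_succ']
      simp only [true_and]
      rw [key, key, runCount_succ_of_none h]
      push_cast; ring
    · simp [runCount_of_some h]

/-- Sorting the internal nodes by level allows two samplers to be compared level by level. -/
theorem cost_eq_tsum_runCount (t : BitSampler α) :
    t.cost = ∑' c, (runCount c t : ℝ≥0∞) * 2⁻¹ ^ c := by
  classical
  rw [cost_eq_tsum_ite, tsum_list_bool_length]
  exact tsum_congr fun c => tsum_internal_length c t

open scoped Classical in
theorem sum_tsum_leaf_length (c : ℕ) (t : BitSampler α) (a : α) :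
    (∑ d ∈ Finset.range (c + 1), ∑' s : List Bool, if s.length = d then
      (if t.Leaf a s then (2⁻¹ : ℝ≥0∞) ^ s.length else 0) else 0) = probUpTo c t a := by
  induction c generalizing t with
  | zero =>
    rw [Finset.sum_range_one, tsum_list_bool_length_zero, leaf_nil]
    simp [probUpTo, stopCount]
  | succ c ih =>
    rw [Finset.sum_range_succ', tsum_list_bool_length_zero, leaf_nil]
    simp only [tsum_list_bool_length_succ, leaf_cons]
    rcases h : t [] with _ | b
    · have key : ∀ b, (∑ d ∈ Finset.range (c + 1), ∑' s : List Bool, if s.length = d then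
          (if (t.after b).Leaf a s then (2⁻¹ : ℝ≥0∞) ^ (b :: s).length else 0) else 0) =
          2⁻¹ * probUpTo c (t.after b) a := by
        intro b
        rw [← ih (t.after b), Finset.mul_sum]
        refine Finset.sum_congr rfl fun d _ => ?_
        rw [← ENNReal.tsum_mul_left]
        refine tsum_congr fun s => ?_
        split_ifs <;> simp [pow_succ']
      simp only [true_and, Finset.sum_add_distrib]
      rw [key, key, probUpTo_succ_of_none h]
      simp [mul_add]
    · simp [probUpTo_of_some h]

/-- Decision trees may be infinite; truncating at depth `c` is what makes induction available. -/
theorem prob_eq_iSup (t : BitSampler α) (a : α) : t.prob a = ⨆ c, probUpTo c t a := by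
  classical
  rw [prob_eq_tsum_ite, tsum_list_bool_length,
    ENNReal.tsum_eq_iSup_nat' (Filter.tendsto_add_atTop_nat 1)]
  exact iSup_congr fun c => sum_tsum_leaf_length c t a

theorem probUpTo_monotone (t : BitSampler α) (a : α) : Monotone fun c => probUpTo c t a := by
  classical
  intro c d h
  simp only [← sum_tsum_leaf_length]
  exact Finset.sum_le_sum_of_subset (Finset.range_mono (by omega))

theorem probUpTo_le_prob (c : ℕ) (t : BitSampler α) (a : α) : probUpTo c t a ≤ t.prob a := by
  rw [prob_eq_iSup]; exact le_iSup (fun c => probUpTo c t a) c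

open scoped Classical in
theorem prob_of_some {t : BitSampler α} {b : α} (h : t [] = some b) (a : α) :
    t.prob a = if b = a then 1 else 0 := by
  simp [prob_eq_iSup, probUpTo_of_some h]

theorem prob_of_none {t : BitSampler α} (h : t [] = none) (a : α) :
    t.prob a = 2⁻¹ * ((t.after false).prob a + (t.after true).prob a) := by
  rw [prob_eq_iSup, prob_eq_iSup, prob_eq_iSup,
    ENNReal.iSup_add_iSup_of_monotone (probUpTo_monotone _ _) (probUpTo_monotone _ _),
    ENNReal.mul_iSup]
  apply le_antisymm
  · refine iSup_le fun c => ?_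
    rcases c with _ | c
    · simp [probUpTo_zero_of_none h]
    · rw [probUpTo_succ_of_none h]
      exact le_iSup (fun c => 2⁻¹ * (probUpTo c (t.after false) a + probUpTo c (t.after true) a)) c
  · refine iSup_le fun c => ?_
    rw [← probUpTo_succ_of_none h]
    exact le_iSup (fun c => probUpTo c t a) (c + 1)

/-- The expectation of `h` at the output. -/
noncomputable def expect (t : BitSampler α) (h : α → ℝ≥0∞) : ℝ≥0∞ := ∑' a, t.prob a * h a

theorem expect_of_some {t : BitSampler α} {b : α} (hb : t [] = some b) (h : α → ℝ≥0∞) :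
    t.expect h = h b := by
  classical
  simp [expect, prob_of_some hb]

theorem expect_of_none {t : BitSampler α} (ht : t [] = none) (h : α → ℝ≥0∞) :
    t.expect h = 2⁻¹ * ((t.after false).expect h + (t.after true).expect h) := by
  simp only [expect, prob_of_none ht]
  rw [← ENNReal.tsum_add, ← ENNReal.tsum_mul_left]
  exact tsum_congr fun a => by ring

theorem expect_eq_iSup (t : BitSampler α) (h : α → ℝ≥0∞) :
    t.expect h = ⨆ c, ∑' a, probUpTo c t a * h a := by
  simp only [expect, prob_eq_iSup, ENNReal.iSup_mul]
  exact ENNReal.tsum_iSup_of_monotone _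
    fun a c d hcd => mul_le_mul_left (probUpTo_monotone t a hcd) _

theorem tsum_probUpTo_of_some {t : BitSampler α} {b : α} (hb : t [] = some b) (c : ℕ)
    (h : α → ℝ≥0∞) : ∑' a, probUpTo c t a * h a = h b := by
  classical
  simp [probUpTo_of_some hb]

theorem tsum_probUpTo_succ_of_none {t : BitSampler α} (ht : t [] = none) (c : ℕ)
    (h : α → ℝ≥0∞) : ∑' a, probUpTo (c + 1) t a * h a =
      2⁻¹ * (∑' a, probUpTo c (t.after false) a * h a + ∑' a, probUpTo c (t.after true) a * h a) := by
  simp only [probUpTo_succ_of_none ht]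
  rw [← ENNReal.tsum_add, ← ENNReal.tsum_mul_left]
  exact tsum_congr fun a => by ring

theorem bind_of_some {t : BitSampler α} {a : α} (h : t [] = some a) (g : α → BitSampler β) :
    t.bind g = g a := by
  funext s
  cases s <;> simp [bind, h]

theorem bind_nil_of_none {t : BitSampler α} (h : t [] = none) (g : α → BitSampler β) :
    t.bind g [] = none := by
  simp [bind, h]

theorem after_bind_of_none {t : BitSampler α} (h : t [] = none) (g : α → BitSampler β) (b : Bool) :
    (t.bind g).after b = (t.after b).bind g := by
  funext s
  simp only [after, bind, h]
  rfl

/-- Both sides obey the same one-bit recursion, which alone does not determine them on an infinite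
tree. Each inequality is therefore proved for the truncations of its smaller side, by induction on
the depth. -/
theorem prob_bind (t : BitSampler α) (g : α → BitSampler β) (b : β) :
    (t.bind g).prob b = t.expect fun a => (g a).prob b := by
  apply le_antisymm
  · rw [prob_eq_iSup]
    refine iSup_le fun c => ?_
    induction c generalizing t with
    | zero =>
      rcases h : t [] with _ | a
      · simp [probUpTo_zero_of_none (bind_nil_of_none h g)]
      · rw [bind_of_some h, expect_of_some h]
        exact probUpTo_le_prob _ _ _
    | succ c ih =>
      rcases h : t [] with _ | a
      · rw [probUpTo_succ_of_none (bind_nil_of_none h g), after_bind_of_none h,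
          after_bind_of_none h, expect_of_none h]
        gcongr <;> exact ih _
      · rw [bind_of_some h, expect_of_some h]
        exact probUpTo_le_prob _ _ _
  · rw [expect_eq_iSup]
    refine iSup_le fun c => ?_
    induction c generalizing t with
    | zero =>
      rcases h : t [] with _ | a
      · simp [probUpTo_zero_of_none h]
      · rw [bind_of_some h, tsum_probUpTo_of_some h]
    | succ c ih =>
      rcases h : t [] with _ | a
      · rw [tsum_probUpTo_succ_of_none h, prob_of_none (bind_nil_of_none h g),
          after_bind_of_none h, after_bind_of_none h]
        gcongr <;> exact ih _
      · rw [bind_of_some h, tsum_probUpTo_of_some h]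

/-- The expected number of bits that are read among the first `c` bits. -/
noncomputable def costUpTo (c : ℕ) (t : BitSampler α) : ℝ≥0∞ :=
  ∑ d ∈ Finset.range c, (runCount d t : ℝ≥0∞) * 2⁻¹ ^ d

theorem costUpTo_of_some {t : BitSampler α} {b : α} (h : t [] = some b) (c : ℕ) :
    costUpTo c t = 0 := by
  simp [costUpTo, runCount_of_some h]

theorem costUpTo_succ_of_none {t : BitSampler α} (h : t [] = none) (c : ℕ) :
    costUpTo (c + 1) t = 1 + 2⁻¹ * (costUpTo c (t.after false) + costUpTo c (t.after true)) := by
  rw [costUpTo, Finset.sum_range_succ', runCount_zero_of_none h, add_comm]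
  simp only [costUpTo, runCount_succ_of_none h]
  rw [← Finset.sum_add_distrib, Finset.mul_sum]
  congr 1
  · simp
  · exact Finset.sum_congr rfl fun d _ => by push_cast; ring

theorem cost_eq_iSup (t : BitSampler α) : t.cost = ⨆ c, costUpTo c t := by
  rw [cost_eq_tsum_runCount, ENNReal.tsum_eq_iSup_nat]; rfl

theorem costUpTo_monotone (t : BitSampler α) : Monotone fun c => costUpTo c t :=
  fun _ _ h => Finset.sum_le_sum_of_subset (Finset.range_mono h)

theorem costUpTo_le_cost (c : ℕ) (t : BitSampler α) : costUpTo c t ≤ t.cost := by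
  rw [cost_eq_iSup]; exact le_iSup (fun c => costUpTo c t) c

theorem cost_of_some {t : BitSampler α} {b : α} (h : t [] = some b) : t.cost = 0 := by
  simp [cost_eq_iSup, costUpTo_of_some h]

theorem cost_of_none {t : BitSampler α} (h : t [] = none) :
    t.cost = 1 + 2⁻¹ * ((t.after false).cost + (t.after true).cost) := by
  rw [cost_eq_tsum_runCount, tsum_eq_zero_add' ENNReal.summable, runCount_zero_of_none h]
  simp only [runCount_succ_of_none h, cost_eq_tsum_runCount]
  rw [← ENNReal.tsum_add, ← ENNReal.tsum_mul_left]
  congr 1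
  · simp
  · exact tsum_congr fun d => by push_cast; ring

theorem cost_bind (t : BitSampler α) (g : α → BitSampler β) :
    (t.bind g).cost = t.cost + t.expect fun a => (g a).cost := by
  apply le_antisymm
  · rw [cost_eq_iSup]
    refine iSup_le fun c => ?_
    induction c generalizing t with
    | zero => simp [costUpTo]
    | succ c ih =>
      rcases h : t [] with _ | a
      · rw [costUpTo_succ_of_none (bind_nil_of_none h g), after_bind_of_none h,
          after_bind_of_none h, cost_of_none h, expect_of_none h, add_assoc, ← mul_add,
          add_add_add_comm]
        gcongr <;> exact ih _
      · rw [bind_of_some h, expect_of_some h, cost_of_some h, zero_add]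
        exact costUpTo_le_cost _ _
  -- Monotonicity merges the two suprema into one, so that a single depth is used in the induction.
  · have hmono : Monotone fun c => ∑' a, probUpTo c t a * (g a).cost := fun c d hcd =>
      ENNReal.tsum_le_tsum fun a => mul_le_mul_left (probUpTo_monotone t a hcd) _
    rw [expect_eq_iSup, cost_eq_iSup t,
      ENNReal.iSup_add_iSup_of_monotone (costUpTo_monotone t) hmono]
    clear hmono
    refine iSup_le fun c => ?_
    induction c generalizing t with
    | zero =>
      rcases h : t [] with _ | a
      · simp [probUpTo_zero_of_none h, costUpTo]
      · rw [bind_of_some h, tsum_probUpTo_of_some h, costUpTo_of_some h, zero_add]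
    | succ c ih =>
      rcases h : t [] with _ | a
      · rw [tsum_probUpTo_succ_of_none h, cost_of_none (bind_nil_of_none h g),
          after_bind_of_none h, after_bind_of_none h, costUpTo_succ_of_none h, add_assoc, ← mul_add,
          add_add_add_comm]
        gcongr <;> exact ih _
      · rw [bind_of_some h, tsum_probUpTo_of_some h, costUpTo_of_some h, zero_add]

theorem runCount_eq_two_pow {c : ℕ} {t : BitSampler α} (h : ∀ a, stopCount c t a = 0) :
    runCount c t = 2 ^ c := by
  classical
  induction c generalizing t with
  | zero =>
    rcases ht : t [] with _ | b
    · simp [runCount_zero_of_none ht]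
    · have := h b
      simp [stopCount_of_some ht] at this
  | succ c ih =>
    rcases ht : t [] with _ | b
    · simp only [stopCount_succ_of_none ht, Nat.add_eq_zero_iff] at h
      rw [runCount_succ_of_none ht, ih fun a => (h a).1, ih fun a => (h a).2, pow_succ]
      ring
    · have := h b
      simp [stopCount_of_some ht] at this

/-- An algorithm that is uniform on a set with at least `2 ^ d` elements reads at least `d` bits. -/
theorem IsUniformOn.le_cost {t : BitSampler α} {S : Set α} (ht : t.IsUniformOn S) {F : Finset α}
    (hF : ∀ a ∈ F, a ∈ S) {d : ℕ} (hd : 2 ^ d ≤ F.card) : (d : ℝ≥0∞) ≤ t.cost := by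
  obtain ⟨hsum, hout, heq⟩ := ht
  have hrun : ∀ c < d, runCount c t = 2 ^ c := by
    intro c hc
    refine runCount_eq_two_pow fun a => ?_
    -- A string stopped on `a` by level `c < d` gives `a`, hence every element of `S`, probability
    -- at least `2^(-c)`; over `F` this adds up to at least 2.
    by_contra hne
    have h1 : (2⁻¹ : ℝ≥0∞) ^ c ≤ t.prob a := by
      refine le_trans ?_ (probUpTo_le_prob c t a)
      exact le_mul_of_one_le_left zero_le (by exact_mod_cast Nat.one_le_iff_ne_zero.2 hne)
    have ha : a ∈ S := by
      by_contra ha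
      rw [hout a ha] at h1
      simp at h1
    have h2 : (F.card : ℝ≥0∞) * t.prob a ≤ 1 := by
      rw [← hsum, ← nsmul_eq_mul, ← Finset.sum_const]
      refine le_trans (Finset.sum_le_sum fun b hb => (heq a ha b (hF b hb)).le) ?_
      exact ENNReal.sum_le_tsum F
    have h3 : (2 : ℝ≥0∞) ^ (c + 1) * 2⁻¹ ^ c ≤ 1 := by
      refine le_trans (mul_le_mul' ?_ h1) h2
      exact_mod_cast (Nat.pow_le_pow_right (by norm_num) hc).trans hd
    rw [pow_succ', mul_assoc, two_pow_mul_inv_two_pow, mul_one] at h3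
    exact absurd h3 (by norm_num)
  calc (d : ℝ≥0∞) = costUpTo d t := by
        rw [costUpTo, Finset.sum_congr rfl fun c hc => by
          rw [hrun c (Finset.mem_range.1 hc), Nat.cast_pow, Nat.cast_ofNat,
            two_pow_mul_inv_two_pow]]
        simp
    _ ≤ t.cost := costUpTo_le_cost d t

theorem cost_ofOption_some (a : α) : (ofOption (some a)).cost = 0 := cost_of_some rfl

theorem prob_ofOption_some [DecidableEq α] (a b : α) :
    (ofOption (some a)).prob b = if a = b then 1 else 0 := by
  rw [prob_of_some (t := ofOption (some a)) (b := a) rfl]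
  congr

end BitSampler

/-! ### Knuth-Yao sampling: exactness and optimality -/

section KnuthYao

open BitSampler

variable {k : ℕ}

theorem sum_pos_of_ne_zero {n : Fin k → ℕ} (hn : n ≠ 0) : 0 < ∑ j, n j := by
  rw [Nat.pos_iff_ne_zero]
  intro h
  exact hn (funext fun i => (Finset.sum_eq_zero_iff.1 h) i (Finset.mem_univ i))

theorem IsLetterSampler.sum_prob {D : (Fin k → ℕ) → BitSampler (Fin k)} (hD : IsLetterSampler D)
    {n : Fin k → ℕ} (hn : n ≠ 0) : ∑ i, (D n).prob i = 1 := by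
  simp only [hD n hn, ENNReal.div_eq_inv_mul]
  rw [← Finset.mul_sum, ← Nat.cast_sum, ENNReal.inv_mul_cancel]
  · exact_mod_cast (sum_pos_of_ne_zero hn).ne'
  · exact ENNReal.natCast_ne_top _

/-- The mass stopped on `i` by level `c` is at most `n_i / ∑ n_j` and is an integer multiple of
`2^(-c)`, whence the floor. -/
theorem stopCount_le_div {D : (Fin k → ℕ) → BitSampler (Fin k)} (hD : IsLetterSampler D)
    {n : Fin k → ℕ} (hn : n ≠ 0) (c : ℕ) (i : Fin k) :
    stopCount c (D n) i ≤ 2 ^ c * n i / ∑ j, n j := by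
  have hN := sum_pos_of_ne_zero hn
  rw [Nat.le_div_iff_mul_le hN]
  have h1 := probUpTo_le_prob c (D n) i
  rw [hD n hn, probUpTo, ENNReal.le_div_iff_mul_le (.inl (by exact_mod_cast hN.ne'))
    (.inl (ENNReal.natCast_ne_top _))] at h1
  have h2 := mul_le_mul_right h1 ((2 : ℝ≥0∞) ^ c)
  have h3 : (2 : ℝ≥0∞) ^ c * (stopCount c (D n) i * 2⁻¹ ^ c * (∑ j, n j : ℕ)) =
      stopCount c (D n) i * (∑ j, n j : ℕ) := by
    rw [mul_right_comm, ← mul_assoc, mul_comm, ← mul_assoc, mul_comm (2⁻¹ ^ c),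
      two_pow_mul_inv_two_pow, one_mul]
  rw [h3] at h2
  exact_mod_cast h2

/-- The number of nodes at level `c` of the Knuth-Yao tree. -/
def kyWidth (n : Fin k → ℕ) (c : ℕ) : ℕ := 2 ^ c - ∑ i, 2 * ((2 ^ c * n i / ∑ j, n j) / 2)

theorem sum_div_le (n : Fin k → ℕ) (c : ℕ) : ∑ i, 2 ^ c * n i / ∑ j, n j ≤ 2 ^ c := by
  rcases Nat.eq_zero_or_pos (∑ j, n j) with h | h
  · simp [h]
  · rw [← Nat.mul_le_mul_right_iff h, Finset.sum_mul]
    refine (Finset.sum_le_sum fun i _ => Nat.div_mul_le_self _ _).trans ?_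
    rw [← Finset.mul_sum]

theorem length_kyLabels (n : Fin k → ℕ) (c : ℕ) :
    (kyLabels n c).length = ∑ i, (2 ^ c * n i / ∑ j, n j) % 2 := by
  rw [kyLabels, ← List.countP_eq_length_filter]
  have : ∀ l : List (Fin k), l.countP (fun i => decide ((2 ^ c * n i / ∑ j, n j) % 2 = 1)) =
      (l.map fun i => (2 ^ c * n i / ∑ j, n j) % 2).sum := by
    intro l
    induction l with
    | nil => rfl
    | cons a l ih =>
      rw [List.countP_cons, ih, List.map_cons, List.sum_cons]
      rcases Nat.mod_two_eq_zero_or_one (2 ^ c * n a / ∑ j, n j) with h | h <;> simp [h, add_comm]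
  rw [this, ← List.ofFn_eq_map, List.sum_ofFn]

theorem length_kyLabels_add (n : Fin k → ℕ) (c : ℕ) :
    (kyLabels n c).length + ∑ i, 2 * ((2 ^ c * n i / ∑ j, n j) / 2) =
      ∑ i, 2 ^ c * n i / ∑ j, n j := by
  rw [length_kyLabels, ← Finset.sum_add_distrib]
  exact Finset.sum_congr rfl fun i _ => Nat.mod_add_div _ _

theorem two_pow_succ_mul_div_div (n : Fin k → ℕ) (c : ℕ) (i : Fin k) :
    (2 ^ (c + 1) * n i / ∑ j, n j) / 2 = 2 ^ c * n i / ∑ j, n j := by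
  rw [Nat.div_div_eq_div_mul, mul_comm (∑ j, n j), ← Nat.div_div_eq_div_mul]
  congr 1
  rw [pow_succ, mul_right_comm]
  simp

theorem length_kyLabels_le (n : Fin k → ℕ) (c : ℕ) : (kyLabels n c).length ≤ kyWidth n c := by
  have h1 := length_kyLabels_add n c
  have h2 := sum_div_le n c
  rw [kyWidth]; omega

/-- The terms subtracted in `kyWidth` are the positions of level `c` lying below earlier leaves,
because halving the floor at level `c + 1` gives back the floor at level `c`. -/
theorem kyWidth_succ (n : Fin k → ℕ) (c : ℕ) :
    kyWidth n (c + 1) = 2 * (kyWidth n c - (kyLabels n c).length) := by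
  have h1 := length_kyLabels_add n c
  have h2 := sum_div_le n c
  rw [kyWidth, kyWidth]
  simp only [two_pow_succ_mul_div_div]
  rw [← Finset.mul_sum, pow_succ]
  omega

theorem count_kyLabels (n : Fin k → ℕ) (c : ℕ) (i : Fin k) :
    (kyLabels n c).count i = (2 ^ c * n i / ∑ j, n j) % 2 := by
  rw [kyLabels]
  rcases Nat.mod_two_eq_zero_or_one (2 ^ c * n i / ∑ j, n j) with h | h
  · rw [h, List.count_eq_zero]
    simp [h]
  · rw [h, List.count_filter (by simpa using h)]
    exact List.count_eq_one_of_mem (List.nodup_finRange k) (List.mem_finRange i)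

theorem sum_range_getElem?_eq_count {α : Type*} [DecidableEq α] (l : List α) (a : α) :
    ∑ d ∈ Finset.range l.length, (if l[d]? = some a then 1 else 0) = l.count a := by
  induction l with
  | nil => rfl
  | cons b l ih =>
    rw [List.length_cons, Finset.sum_range_succ', List.count_cons, ← ih]
    simp

theorem Finset.sum_range_two_mul (m : ℕ) (f : ℕ → ℕ) :
    ∑ d ∈ Finset.range (2 * m), f d = ∑ d ∈ Finset.range m, (f (2 * d) + f (2 * d + 1)) := by
  induction m with
  | zero => rfl
  | succ m ih => rw [Nat.mul_succ, Finset.sum_range_succ, Finset.sum_range_succ, ih,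
      Finset.sum_range_succ, add_assoc]

theorem kyFrom_nil (n : Fin k → ℕ) (c d : ℕ) : kyFrom n c d [] = (kyLabels n c)[d]? := rfl

theorem after_kyFrom {n : Fin k → ℕ} {c d : ℕ} (h : (kyLabels n c).length ≤ d) (b : Bool) :
    (kyFrom n c d).after b = kyFrom n (c + 1) (2 * (d - (kyLabels n c).length) + b.toNat) := by
  funext s
  simp [after, kyFrom, Nat.not_lt.2 h]

theorem kyFrom_length_add_nil (n : Fin k → ℕ) (c d : ℕ) :
    kyFrom n c ((kyLabels n c).length + d) [] = none := by
  rw [kyFrom_nil]; simp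

theorem sum_stopCount_kyFrom_split (n : Fin k → ℕ) (e c : ℕ) (i : Fin k) :
    ∑ d ∈ Finset.range (kyWidth n c), stopCount e (kyFrom n c d) i =
      2 ^ e * ((2 ^ c * n i / ∑ j, n j) % 2) +
        ∑ d ∈ Finset.range (kyWidth n c - (kyLabels n c).length),
          stopCount e (kyFrom n c ((kyLabels n c).length + d)) i := by
  obtain ⟨r, hr⟩ := Nat.exists_eq_add_of_le (length_kyLabels_le n c)
  rw [hr, Finset.sum_range_add, Nat.add_sub_cancel_left, ← count_kyLabels,
    ← sum_range_getElem?_eq_count, Finset.mul_sum]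
  congr 1
  refine Finset.sum_congr rfl fun d hd => ?_
  have hd' := Finset.mem_range.1 hd
  rw [stopCount_of_some (b := (kyLabels n c)[d]) (by rw [kyFrom_nil]; simp [hd'])]
  simp [hd']

/-- The induction runs over whole levels: the leaves of level `c` contribute the current digit, and
the two sons of the remaining nodes fill level `c + 1` exactly. The extra summand stands for the
strings below leaves of levels less than `c`. -/
theorem sum_stopCount_kyFrom (n : Fin k → ℕ) (e c : ℕ) (i : Fin k) :
    ∑ d ∈ Finset.range (kyWidth n c), stopCount e (kyFrom n c d) i +
      2 ^ e * (2 * ((2 ^ c * n i / ∑ j, n j) / 2)) = 2 ^ (c + e) * n i / ∑ j, n j := by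
  induction e generalizing c with
  | zero =>
    rw [sum_stopCount_kyFrom_split, Finset.sum_eq_zero fun d _ =>
      stopCount_zero_of_none (kyFrom_length_add_nil n c d) i]
    simp [Nat.mod_add_div]
  | succ e ih =>
    rw [sum_stopCount_kyFrom_split]
    simp only [stopCount_succ_of_none (kyFrom_length_add_nil n c _),
      after_kyFrom (Nat.le_add_right _ _),
      Nat.add_sub_cancel_left, Bool.toNat_false, Bool.toNat_true, add_zero]
    rw [← Finset.sum_range_two_mul _ fun d => stopCount e (kyFrom n (c + 1) d) i, ← kyWidth_succ]
    have h := ih (c + 1)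
    rw [two_pow_succ_mul_div_div, add_right_comm c 1 e] at h
    rw [← add_assoc c e 1, ← h]
    nth_rw 3 [← Nat.mod_add_div (2 ^ c * n i / ∑ j, n j) 2]
    ring

theorem stopCount_knuthYao {n : Fin k → ℕ} (hn : n ≠ 0) (c : ℕ) (i : Fin k) :
    stopCount c (knuthYao n) i = 2 ^ c * n i / ∑ j, n j := by
  have hN := sum_pos_of_ne_zero hn
  have hhalf : ∀ i, (2 ^ 0 * n i / ∑ j, n j) / 2 = 0 := by
    intro i
    rw [Nat.div_div_eq_div_mul]
    refine Nat.div_eq_of_lt ?_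
    have := Finset.single_le_sum (fun j _ => Nat.zero_le (n j)) (Finset.mem_univ i)
    omega
  have h := sum_stopCount_kyFrom n c 0 i
  have hw : kyWidth n 0 = 1 := by
    rw [kyWidth]
    simp only [hhalf]
    simp
  rw [hhalf, hw, Finset.sum_range_one] at h
  simpa [knuthYao] using h

theorem runCount_knuthYao_le {n : Fin k → ℕ} (hn : n ≠ 0) (c : ℕ) :
    runCount c (knuthYao n) ≤ k := by
  have hN := sum_pos_of_ne_zero hn
  have h := sum_stopCount_add_runCount c (knuthYao n)
  simp only [stopCount_knuthYao hn] at h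
  suffices h' : 2 ^ c ≤ ∑ i, 2 ^ c * n i / ∑ j, n j + k by omega
  rw [← Nat.mul_le_mul_right_iff hN]
  calc 2 ^ c * ∑ j, n j = ∑ i, 2 ^ c * n i := Finset.mul_sum _ _ _
    _ ≤ ∑ i, (2 ^ c * n i / ∑ j, n j + 1) * ∑ j, n j :=
        Finset.sum_le_sum fun i _ => (Nat.lt_div_mul_add hN).le.trans_eq (by ring)
    _ = _ := by rw [← Finset.sum_mul, Finset.sum_add_distrib]; simp

/-- An algorithm is an exact sampler for `D_n` if it underestimates no probability after
finitely many bits and has boundedly many internal nodes on each level. -/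
theorem prob_eq_of_stopCount_le {t : BitSampler (Fin k)} {n : Fin k → ℕ} (hn : n ≠ 0)
    (hcount : ∀ c i, stopCount c t i * ∑ j, n j ≤ 2 ^ c * n i) {r : ℕ}
    (hrun : ∀ c, runCount c t ≤ r) (i : Fin k) :
    t.prob i = (n i : ℝ≥0∞) / ((∑ j, n j : ℕ) : ℝ≥0∞) := by
  have hN := sum_pos_of_ne_zero hn
  have hN0 : ((∑ j, n j : ℕ) : ℝ≥0∞) ≠ 0 := by exact_mod_cast hN.ne'
  have hle : ∀ i, t.prob i ≤ (n i : ℝ≥0∞) / ((∑ j, n j : ℕ) : ℝ≥0∞) := by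
    intro i
    rw [prob_eq_iSup]
    refine iSup_le fun c => ?_
    rw [ENNReal.le_div_iff_mul_le (.inl hN0) (.inl (ENNReal.natCast_ne_top _)), probUpTo,
      mul_right_comm]
    calc (stopCount c t i : ℝ≥0∞) * (∑ j, n j : ℕ) * 2⁻¹ ^ c ≤ (2 ^ c * n i) * 2⁻¹ ^ c := by
          gcongr ?_ * _; exact_mod_cast hcount c i
      _ = n i := by rw [mul_right_comm, two_pow_mul_inv_two_pow, one_mul]
  -- The mass still running at level `c` is at most `r * 2^(-c)`, which tends to 0.
  have hone : 1 ≤ ∑ i, t.prob i := by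
    have hlim : Filter.Tendsto (fun c : ℕ => ∑ i, t.prob i + (r : ℝ≥0∞) * 2⁻¹ ^ c) Filter.atTop
        (nhds (∑ i, t.prob i + r * 0)) :=
      tendsto_const_nhds.add (ENNReal.Tendsto.const_mul
        (ENNReal.tendsto_pow_atTop_nhds_zero_of_lt_one (by norm_num))
        (.inr (ENNReal.natCast_ne_top _)))
    rw [mul_zero, add_zero] at hlim
    refine ge_of_tendsto' hlim fun c => ?_
    calc (1 : ℝ≥0∞) = ((∑ i, stopCount c t i + runCount c t : ℕ) : ℝ≥0∞) * 2⁻¹ ^ c := by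
          rw [sum_stopCount_add_runCount]; push_cast; exact (two_pow_mul_inv_two_pow c).symm
      _ = ∑ i, probUpTo c t i + runCount c t * 2⁻¹ ^ c := by
          push_cast; rw [add_mul, Finset.sum_mul]; rfl
      _ ≤ _ := by
          gcongr
          · exact probUpTo_le_prob _ _ _
          · exact_mod_cast hrun c
  -- The upper bounds `hle` have total 1, so none can be strict; cancelling the other letters
  -- requires their sum to be finite.
  refine le_antisymm (hle i) ?_
  have hp : ∑ i, (n i : ℝ≥0∞) / ((∑ j, n j : ℕ) : ℝ≥0∞) = 1 := by
    simp only [ENNReal.div_eq_inv_mul]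
    rw [← Finset.mul_sum, ← Nat.cast_sum, ENNReal.inv_mul_cancel hN0 (ENNReal.natCast_ne_top _)]
  rw [← hp, ← Finset.add_sum_erase _ t.prob (Finset.mem_univ i), ← Finset.add_sum_erase _
    (fun i => (n i : ℝ≥0∞) / ((∑ j, n j : ℕ) : ℝ≥0∞)) (Finset.mem_univ i)] at hone
  have hfin : ∑ x ∈ Finset.univ.erase i, (n x : ℝ≥0∞) / ((∑ j, n j : ℕ) : ℝ≥0∞) ≠ ⊤ := by
    refine ne_top_of_le_ne_top ENNReal.one_ne_top (hp ▸ ?_)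
    exact Finset.sum_le_sum_of_subset (Finset.erase_subset _ _)
  refine (ENNReal.add_le_add_iff_right hfin).1 (hone.trans ?_)
  gcongr
  exact hle _

theorem isLetterSampler_knuthYao : IsLetterSampler (knuthYao (k := k)) := fun _ hn =>
  prob_eq_of_stopCount_le hn
    (fun c i => stopCount_knuthYao hn c i ▸ Nat.div_mul_le_self _ _) (runCount_knuthYao_le hn)

/-- On each level Knuth-Yao has stopped on as many strings as exactness permits, so it has the
fewest still running. -/
theorem cost_knuthYao_le {D : (Fin k → ℕ) → BitSampler (Fin k)} (hD : IsLetterSampler D)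
    {n : Fin k → ℕ} (hn : n ≠ 0) : (knuthYao n).cost ≤ (D n).cost := by
  rw [cost_eq_tsum_runCount, cost_eq_tsum_runCount]
  refine ENNReal.tsum_le_tsum fun c => ?_
  gcongr
  have h1 := sum_stopCount_add_runCount c (knuthYao n)
  have h2 := sum_stopCount_add_runCount c (D n)
  have h3 : ∑ i, stopCount c (D n) i ≤ ∑ i, stopCount c (knuthYao n) i :=
    Finset.sum_le_sum fun i _ => stopCount_knuthYao hn c i ▸ stopCount_le_div hD hn c i
  omega

/-- Writing `k = 2^a x` with `1 ≤ x ≤ 2` reduces this to `x - 1 ≤ log₂ x`, which is Bernoulli's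
inequality `2^(x-1) ≤ x` for an exponent in `[0, 1]`. -/
theorem log_add_le_logb (hk : k ≠ 0) :
    (Nat.log 2 k : ℝ) + 1 + k * 2⁻¹ ^ Nat.log 2 k ≤ 2 + Real.logb 2 k := by
  set a := Nat.log 2 k
  set x : ℝ := k * 2⁻¹ ^ a with hx
  have hpow : (0 : ℝ) < 2 ^ a := by positivity
  have hkx : (k : ℝ) = 2 ^ a * x := by rw [hx, inv_pow]; field_simp
  have h1 : 1 ≤ x := by
    have : (2 : ℝ) ^ a ≤ k := by exact_mod_cast Nat.pow_log_le_self 2 hk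
    rw [hkx] at this
    nlinarith
  have h2 : x ≤ 2 := by
    have : (k : ℝ) < 2 ^ (a + 1) := by exact_mod_cast Nat.lt_pow_succ_log_self (by norm_num) k
    rw [hkx, pow_succ] at this
    nlinarith
  have h3 := rpow_one_add_le_one_add_mul_self (s := 1) (by norm_num) (p := x - 1) (by linarith)
    (by linarith)
  have h4 : x - 1 ≤ Real.logb 2 x := by
    rw [Real.le_logb_iff_rpow_le (by norm_num) (by linarith)]
    norm_num at h3 ⊢
    linarith
  rw [hkx, Real.logb_mul hpow.ne' (by linarith), Real.logb_pow, Real.logb_self_eq_one (by norm_num)]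
  linarith

/-- Levels up to `a = ⌊log₂ k⌋` contribute at most 1 each, having at most `2^c` nodes; the later
ones form a geometric tail of sum `k * 2^(-a)`. -/
theorem cost_le_of_runCount_le {α : Type} {t : BitSampler α} (hk : k ≠ 0)
    (h : ∀ c, runCount c t ≤ k) : t.cost ≤ ENNReal.ofReal (2 + Real.logb 2 k) := by
  set a := Nat.log 2 k with ha
  rw [cost_eq_tsum_runCount, ← ENNReal.summable.sum_add_tsum_nat_add' (k := a + 1)]
  have h1 : ∑ c ∈ Finset.range (a + 1), (runCount c t : ℝ≥0∞) * 2⁻¹ ^ c ≤ (a + 1 : ℕ) := by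
    calc _ ≤ ∑ c ∈ Finset.range (a + 1), (1 : ℝ≥0∞) := by
          refine Finset.sum_le_sum fun c _ => ?_
          rw [← two_pow_mul_inv_two_pow c]
          gcongr
          exact_mod_cast runCount_le_two_pow c t
      _ = _ := by simp
  have h2 : ∑' c, (runCount (c + (a + 1)) t : ℝ≥0∞) * 2⁻¹ ^ (c + (a + 1)) ≤ k * 2⁻¹ ^ a := by
    calc _ ≤ ∑' c : ℕ, (k : ℝ≥0∞) * 2⁻¹ ^ (c + (a + 1)) := by
          refine ENNReal.tsum_le_tsum fun c => ?_
          gcongr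
          exact h _
      _ = k * 2⁻¹ ^ (a + 1) * ∑' c : ℕ, 2⁻¹ ^ c := by
          rw [← ENNReal.tsum_mul_left]
          exact tsum_congr fun c => by ring
      _ = k * 2⁻¹ ^ a * (2⁻¹ * 2) := by
          rw [ENNReal.tsum_geometric, ENNReal.one_sub_inv_two, inv_inv]; ring
      _ = _ := by rw [ENNReal.inv_mul_cancel (by norm_num) (by norm_num), mul_one]
  refine (add_le_add h1 h2).trans ?_
  have h3 : ((a + 1 : ℕ) : ℝ≥0∞) + k * 2⁻¹ ^ a =
      ENNReal.ofReal ((Nat.log 2 k : ℝ) + 1 + k * 2⁻¹ ^ Nat.log 2 k) := by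
    rw [ENNReal.ofReal_add (by positivity) (by positivity), ENNReal.ofReal_mul (by positivity),
      ENNReal.ofReal_pow (by positivity), ENNReal.ofReal_inv_of_pos (by norm_num),
      ENNReal.ofReal_natCast, ENNReal.ofReal_ofNat, ← ha, ← Nat.cast_succ, ENNReal.ofReal_natCast]
  rw [h3]
  exact ENNReal.ofReal_le_ofReal (log_add_le_logb hk)

end KnuthYao

/-! ### Dichotomic sampling: exactness and cost -/

section Dichotomic

open BitSampler

variable {k : ℕ}

/-- The relation is arbitrary so that increasing and decreasing searches are both covered: `moveUp`,
`moveDown` and `cutIndex`. -/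
theorem List.exists_find?_eq_some_of_pairwise {α : Type*} {r : α → α → Prop} {p : α → Bool}
    {l : List α} (hl : l.Pairwise r) {y : α} (hy : y ∈ l) (hp : p y) :
    ∃ x, l.find? p = some x ∧ p x ∧ ∀ a ∈ l, p a → a = x ∨ r x a := by
  induction l with
  | nil => simp at hy
  | cons b l ih =>
    rw [List.pairwise_cons] at hl
    by_cases hb : p b
    · refine ⟨b, by simp [hb], hb, fun a ha _ => ?_⟩
      rcases List.mem_cons.1 ha with rfl | ha
      · exact .inl rfl
      · exact .inr (hl.1 a ha)
    · obtain ⟨x, h1, h2, h3⟩ := ih hl.2 ((List.mem_cons.1 hy).resolve_left (by rintro rfl; exact hb hp))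
      refine ⟨x, by simp [hb, h1], h2, fun a ha hpa => ?_⟩
      rcases List.mem_cons.1 ha with rfl | ha
      · exact absurd hpa hb
      · exact h3 a ha hpa

theorem partialSum_mono (n : Fin k → ℕ) : Monotone (partialSum n) := by
  intro a b hab
  refine Finset.sum_le_sum fun j _ => ?_
  split_ifs <;> omega

theorem partialSum_zero (n : Fin k → ℕ) : partialSum n 0 = 0 := by simp [partialSum]

theorem partialSum_of_le (n : Fin k → ℕ) {l : ℕ} (hl : k ≤ l) : partialSum n l = ∑ j, n j :=
  Finset.sum_congr rfl fun j _ => if_pos (j.2.trans_le hl)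

theorem partialSum_succ (n : Fin k → ℕ) (l : Fin k) :
    partialSum n (l + 1) = partialSum n l + n l := by
  have : n l = ∑ j : Fin k, if j = l then n j else 0 := by simp
  rw [partialSum, partialSum, this, ← Finset.sum_add_distrib]
  refine Finset.sum_congr rfl fun j _ => ?_
  by_cases h : j = l
  · simp [h]
  · have : (j : ℕ) ≠ l := fun h' => h (Fin.ext h')
    simp only [h, if_false, add_zero]
    congr 1
    exact propext (by omega)

theorem moveUp_spec {n : Fin k → ℕ} {i j : Fin k} {lo : ℚ} (hij : i ≤ j)
    (hi : (partialSum n i : ℚ) ≤ lo) (hj : lo < partialSum n (j + 1)) :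
    i ≤ moveUp n lo i ∧ moveUp n lo i ≤ j ∧ (partialSum n (moveUp n lo i) : ℚ) ≤ lo ∧
      lo < partialSum n (moveUp n lo i + 1) := by
  obtain ⟨x, h1, h2, h3⟩ := List.exists_find?_eq_some_of_pairwise
    (p := fun l : Fin k => decide (i ≤ l ∧ lo < partialSum n (l + 1)))
    (List.pairwise_lt_finRange k) (List.mem_finRange j) (by simpa using ⟨hij, hj⟩)
  have hx : moveUp n lo i = x := by rw [moveUp, h1, Option.getD_some]
  simp only [decide_eq_true_eq] at h2 h3
  rw [hx]
  refine ⟨h2.1, ?_, ?_, h2.2⟩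
  · rcases h3 j (List.mem_finRange j) ⟨hij, hj⟩ with h | h
    · exact h.ge
    · exact h.le
  · rcases h2.1.eq_or_lt with h | h
    · rwa [← h]
    -- Otherwise part `x - 1` would already end to the right of `lo`, and the search would have
    -- stopped there.
    · by_contra! hlt
      have h' : (i : ℕ) < x := h
      rcases h3 ⟨x - 1, by omega⟩ (List.mem_finRange _) ⟨by rw [Fin.le_def]; simp only; omega, by
        simp only; rwa [Nat.sub_add_cancel (by omega)]⟩ with h4 | h4
      · have := congrArg Fin.val h4
        simp only at this; omega
      · rw [Fin.lt_def] at h4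
        simp only at h4; omega

theorem moveDown_spec {n : Fin k → ℕ} {i j : Fin k} {hi : ℚ} (hij : i ≤ j)
    (h0 : (partialSum n i : ℚ) < hi) (hj : hi ≤ partialSum n (j + 1)) :
    i ≤ moveDown n hi j ∧ moveDown n hi j ≤ j ∧ (partialSum n (moveDown n hi j) : ℚ) < hi ∧
      hi ≤ partialSum n (moveDown n hi j + 1) := by
  obtain ⟨x, h1, h2, h3⟩ := List.exists_find?_eq_some_of_pairwise
    (p := fun l : Fin k => decide (l ≤ j ∧ (partialSum n l : ℚ) < hi)) (r := fun a b => b < a)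
    (List.pairwise_reverse.2 (List.pairwise_lt_finRange k))
    (List.mem_reverse.2 (List.mem_finRange i)) (by simpa using ⟨hij, h0⟩)
  have hx : moveDown n hi j = x := by rw [moveDown, h1, Option.getD_some]
  simp only [decide_eq_true_eq] at h2 h3
  rw [hx]
  refine ⟨?_, h2.1, h2.2, ?_⟩
  · rcases h3 i (List.mem_reverse.2 (List.mem_finRange i)) ⟨hij, h0⟩ with h | h
    · exact h.le
    · exact h.le
  · rcases h2.1.eq_or_lt with h | h
    · rwa [h]
    · by_contra! hlt
      have h' : (x : ℕ) < j := h
      rcases h3 ⟨x + 1, by omega⟩ (List.mem_reverse.2 (List.mem_finRange _))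
        ⟨by rw [Fin.le_def]; simp only; omega, hlt⟩ with h4 | h4
      · have := congrArg Fin.val h4
        simp only at this; omega
      · rw [Fin.lt_def] at h4
        simp only at h4; omega

/-- What is true of the state of dichotomic sampling throughout the loop. -/
structure DichotomicState (n : Fin k → ℕ) (i j : Fin k) (lo hi : ℚ) : Prop where
  le : i ≤ j
  start_le : (partialSum n i : ℚ) ≤ lo
  lt : lo < hi
  le_end : hi ≤ partialSum n (j + 1)

namespace DichotomicState

variable {n : Fin k → ℕ} {i j : Fin k} {lo hi : ℚ}

theorem right (h : DichotomicState n i j lo hi) :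
    DichotomicState n (moveUp n ((lo + hi) / 2) i) j ((lo + hi) / 2) hi := by
  have h1 := h.start_le
  have h2 := h.lt
  have h3 := h.le_end
  obtain ⟨-, h5, h6, -⟩ := moveUp_spec (n := n) (lo := (lo + hi) / 2) h.le (by linarith) (by linarith)
  exact ⟨h5, h6, by linarith, h3⟩

theorem left (h : DichotomicState n i j lo hi) :
    DichotomicState n i (moveDown n ((lo + hi) / 2) j) lo ((lo + hi) / 2) := by
  have h1 := h.start_le
  have h2 := h.lt
  have h3 := h.le_end
  obtain ⟨h5, -, -, h6⟩ := moveDown_spec (n := n) (hi := (lo + hi) / 2) h.le (by linarith) (by linarith)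
  exact ⟨h5, h1, by linarith, h6⟩

/-- In the opposite order, the midpoint would lie strictly before the end of one part and strictly
after the start of a later one. -/
theorem moveDown_le_moveUp (h : DichotomicState n i j lo hi) :
    moveDown n ((lo + hi) / 2) j ≤ moveUp n ((lo + hi) / 2) i := by
  have h1 := h.start_le
  have h2 := h.lt
  have h3 := h.le_end
  obtain ⟨-, -, -, h4⟩ := moveUp_spec (n := n) (lo := (lo + hi) / 2) h.le (by linarith) (by linarith)
  obtain ⟨-, -, h5, -⟩ := moveDown_spec (n := n) (hi := (lo + hi) / 2) h.le (by linarith) (by linarith)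
  by_contra! hlt
  have h6 : (partialSum n (moveUp n ((lo + hi) / 2) i + 1) : ℚ) ≤
      partialSum n (moveDown n ((lo + hi) / 2) j) := by
    exact_mod_cast partialSum_mono n (Fin.lt_def.1 hlt)
  linarith

end DichotomicState

theorem dichotomicLoop_self (n : Fin k → ℕ) (i : Fin k) (lo hi : ℚ) :
    dichotomicLoop n i i lo hi [] = some i := by
  simp [dichotomicLoop]

theorem dichotomicLoop_nil {n : Fin k → ℕ} {i j : Fin k} (hij : i ≠ j) (lo hi : ℚ) :
    dichotomicLoop n i j lo hi [] = none := by
  simp [dichotomicLoop, hij]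

theorem after_dichotomicLoop_true {n : Fin k → ℕ} {i j : Fin k} (hij : i ≠ j) (lo hi : ℚ) :
    (dichotomicLoop n i j lo hi).after true =
      dichotomicLoop n (moveUp n ((lo + hi) / 2) i) j ((lo + hi) / 2) hi := by
  funext s; simp [after, dichotomicLoop, hij]

theorem after_dichotomicLoop_false {n : Fin k → ℕ} {i j : Fin k} (hij : i ≠ j) (lo hi : ℚ) :
    (dichotomicLoop n i j lo hi).after false =
      dichotomicLoop n i (moveDown n ((lo + hi) / 2) j) lo ((lo + hi) / 2) := by
  funext s; simp [after, dichotomicLoop, hij]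

/-- The potential `j - i` is at least 1 at a running node, and by `moveDown_le_moveUp` the
potentials of the two sons add up to at most that of their father. -/
theorem runCount_dichotomicLoop_le {n : Fin k → ℕ} {i j : Fin k} {lo hi : ℚ}
    (h : DichotomicState n i j lo hi) (c : ℕ) :
    runCount c (dichotomicLoop n i j lo hi) + i ≤ j := by
  induction c generalizing i j lo hi with
  | zero =>
    have hle : (i : ℕ) ≤ j := h.le
    by_cases hij : i = j
    · subst hij; simp [runCount_of_some (dichotomicLoop_self n i lo hi)]
    · have : (i : ℕ) ≠ j := fun h' => hij (Fin.ext h')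
      rw [runCount_zero_of_none (dichotomicLoop_nil hij lo hi)]; omega
  | succ c ih =>
    by_cases hij : i = j
    · subst hij; simp [runCount_of_some (dichotomicLoop_self n i lo hi)]
    · rw [runCount_succ_of_none (dichotomicLoop_nil hij lo hi), after_dichotomicLoop_true hij,
        after_dichotomicLoop_false hij]
      have h1 := ih h.left
      have h2 := ih h.right
      have h3 := Fin.le_def.1 h.moveDown_le_moveUp
      omega

/-- The length of the intersection of the `l`-th part with the interval from `lo` to `hi`. -/
def overlap (n : Fin k → ℕ) (l : Fin k) (lo hi : ℚ) : ℚ :=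
  max lo (min hi (partialSum n (l + 1))) - max lo (min hi (partialSum n l))

theorem overlap_nonneg (n : Fin k → ℕ) (l : Fin k) (lo hi : ℚ) : 0 ≤ overlap n l lo hi := by
  have : (partialSum n l : ℚ) ≤ partialSum n (l + 1) := by
    exact_mod_cast partialSum_mono n (Nat.le_succ _)
  rw [overlap, sub_nonneg]
  gcongr

theorem max_min_add_max_min {lo mid hi : ℚ} (h1 : lo ≤ mid) (h2 : mid ≤ hi) (x : ℚ) :
    max lo (min mid x) + max mid (min hi x) = max lo (min hi x) + mid := by
  rcases le_total x mid with h | h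
  · rw [min_eq_right h, min_eq_right (h.trans h2), max_eq_left h]
  · rw [min_eq_left h, max_eq_right h1, max_eq_right (le_min h2 h),
      max_eq_right (h1.trans (le_min h2 h)), add_comm]

theorem overlap_add_overlap (n : Fin k → ℕ) (l : Fin k) {lo mid hi : ℚ} (h1 : lo ≤ mid)
    (h2 : mid ≤ hi) : overlap n l lo mid + overlap n l mid hi = overlap n l lo hi := by
  have h3 := max_min_add_max_min h1 h2 (partialSum n l)
  have h4 := max_min_add_max_min h1 h2 (partialSum n (l + 1))
  rw [overlap, overlap, overlap]
  linarith

/-- A state that stops on `l` has its whole interval inside part `l`, and `overlap` is additive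
under halving. Only an inequality holds, since nodes still running may end in `l` later. -/
theorem stopCount_dichotomicLoop_le {n : Fin k → ℕ} {i j : Fin k} {lo hi : ℚ}
    (h : DichotomicState n i j lo hi) (c : ℕ) (l : Fin k) :
    stopCount c (dichotomicLoop n i j lo hi) l * (hi - lo) ≤ 2 ^ c * overlap n l lo hi := by
  have hself : ∀ {i : Fin k} {lo hi : ℚ} (c : ℕ), DichotomicState n i i lo hi →
      stopCount c (dichotomicLoop n i i lo hi) l * (hi - lo) ≤ 2 ^ c * overlap n l lo hi := by
    intro i lo hi c h
    rw [stopCount_of_some (dichotomicLoop_self n i lo hi)]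
    have hpos := overlap_nonneg n l lo hi
    split_ifs with hil
    · subst hil
      have : overlap n i lo hi = hi - lo := by
        rw [overlap, min_eq_left h.le_end, max_eq_right h.lt.le,
          min_eq_right (h.start_le.trans h.lt.le), max_eq_left h.start_le]
      rw [this]; simp
    · rw [Nat.cast_zero, zero_mul]; positivity
  induction c generalizing i j lo hi with
  | zero =>
    by_cases hij : i = j
    · subst hij; exact hself 0 h
    · rw [stopCount_zero_of_none (dichotomicLoop_nil hij lo hi)]
      simpa using overlap_nonneg n l lo hi
  | succ c ih =>
    by_cases hij : i = j
    · subst hij; exact hself _ h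
    · rw [stopCount_succ_of_none (dichotomicLoop_nil hij lo hi), after_dichotomicLoop_true hij,
        after_dichotomicLoop_false hij]
      have h1 := ih h.left
      have h2 := ih h.right
      have h3 := h.lt
      rw [← overlap_add_overlap n l (mid := (lo + hi) / 2) (by linarith) (by linarith), pow_succ]
      push_cast
      linarith

variable [NeZero k]

theorem dichotomicState_init {n : Fin k → ℕ} (hn : n ≠ 0) :
    DichotomicState n 0 ⊤ 0 ((∑ j, n j : ℕ) : ℚ) := by
  refine ⟨le_top, by simp [partialSum_zero], by exact_mod_cast sum_pos_of_ne_zero hn, ?_⟩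
  have hk := NeZero.pos k
  have h : (⟨k - 1, by omega⟩ : Fin k) ≤ ⊤ := le_top
  rw [Fin.le_def] at h
  rw [partialSum_of_le]
  simp only at h; omega

theorem runCount_dichotomic_le {n : Fin k → ℕ} (hn : n ≠ 0) (c : ℕ) :
    runCount c (dichotomic n) ≤ k := by
  have h1 := runCount_dichotomicLoop_le (dichotomicState_init hn) c
  have h2 := (⊤ : Fin k).2
  rw [dichotomic]; omega

theorem isLetterSampler_dichotomic : IsLetterSampler (dichotomic (k := k)) := by
  intro n hn
  refine prob_eq_of_stopCount_le hn (fun c i => ?_) (runCount_dichotomic_le hn)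
  have h := stopCount_dichotomicLoop_le (dichotomicState_init hn) c i
  have h1 : partialSum n i ≤ ∑ j, n j :=
    partialSum_of_le n le_rfl ▸ partialSum_mono n i.2.le
  have h2 : partialSum n (i + 1) ≤ ∑ j, n j :=
    partialSum_of_le n le_rfl ▸ partialSum_mono n i.2
  have h3 : overlap n i 0 ((∑ j, n j : ℕ) : ℚ) = n i := by
    rw [overlap, min_eq_right (by exact_mod_cast h2), min_eq_right (by exact_mod_cast h1),
      max_eq_right (by positivity), max_eq_right (by positivity), partialSum_succ]
    push_cast; ring
  rw [h3, sub_zero] at h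
  exact_mod_cast h

theorem cost_dichotomic_le {n : Fin k → ℕ} (hn : n ≠ 0) :
    (dichotomic n).cost ≤ ENNReal.ofReal (2 + Real.logb 2 k) :=
  cost_le_of_runCount_le (NeZero.ne k) (runCount_dichotomic_le hn)

end Dichotomic

/-! ### Expectations, and drawing a word letter by letter -/

namespace BitSampler

variable {α β : Type}

theorem expect_mono (t : BitSampler α) {h h' : α → ℝ≥0∞} (hh : ∀ a, t.prob a ≠ 0 → h a ≤ h' a) :
    t.expect h ≤ t.expect h' := by
  refine ENNReal.tsum_le_tsum fun a => ?_
  by_cases ha : t.prob a = 0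
  · simp [ha]
  · gcongr; exact hh a ha

theorem expect_congr (t : BitSampler α) {h h' : α → ℝ≥0∞} (hh : ∀ a, t.prob a ≠ 0 → h a = h' a) :
    t.expect h = t.expect h' :=
  le_antisymm (expect_mono t fun a ha => (hh a ha).le) (expect_mono t fun a ha => (hh a ha).ge)

theorem expect_const (t : BitSampler α) (x : ℝ≥0∞) :
    (t.expect fun _ => x) = (∑' a, t.prob a) * x := ENNReal.tsum_mul_right

theorem tsum_prob_bind (t : BitSampler α) (g : α → BitSampler β) :
    ∑' b, (t.bind g).prob b = t.expect fun a => ∑' b, (g a).prob b := by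
  simp only [prob_bind, expect]
  rw [ENNReal.tsum_comm]
  exact tsum_congr fun a => ENNReal.tsum_mul_left

theorem tsum_prob_ofOption_some (a : α) : ∑' b, (ofOption (some a)).prob b = 1 := by
  classical
  simp [prob_ofOption_some]

end BitSampler

section DrawWord

open BitSampler

variable {k : ℕ} {D D' : (Fin k → ℕ) → BitSampler (Fin k)}

theorem ne_zero_of_sum_eq_succ {n : Fin k → ℕ} {m : ℕ} (hm : ∑ i, n i = m + 1) : n ≠ 0 := by
  rintro rfl; simp at hm

theorem sub_single_add_single {n : Fin k → ℕ} {i : Fin k} (hi : n i ≠ 0) :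
    n - Pi.single i 1 + Pi.single i 1 = n := by
  funext j
  by_cases h : j = i
  · subst h; simp; omega
  · simp [h]

theorem sum_sub_single {n : Fin k → ℕ} {m : ℕ} (hm : ∑ i, n i = m + 1) {i : Fin k}
    (hi : n i ≠ 0) : ∑ j, (n - Pi.single i 1 : Fin k → ℕ) j = m := by
  rw [← sub_single_add_single hi] at hm
  simp only [Pi.add_apply, Finset.sum_add_distrib] at hm
  simpa using hm

theorem prod_factorial_eq {n : Fin k → ℕ} {i : Fin k} (hi : n i ≠ 0) :
    ∏ j, (n j).factorial = n i * ∏ j, ((n - Pi.single i 1 : Fin k → ℕ) j).factorial := by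
  have h1 : (n - Pi.single i 1 : Fin k → ℕ) i = n i - 1 := by simp
  have h2 : ∀ j, j ≠ i → (n - Pi.single i 1 : Fin k → ℕ) j = n j := fun j hj => by simp [hj]
  generalize (n - Pi.single i 1 : Fin k → ℕ) = n' at h1 h2 ⊢
  rw [← Finset.mul_prod_erase _ _ (Finset.mem_univ i),
    ← Finset.mul_prod_erase _ (fun j => (n' j).factorial) (Finset.mem_univ i), ← mul_assoc, h1,
    Nat.mul_factorial_pred hi]
  congr 1
  exact Finset.prod_congr rfl fun j hj => by rw [h2 j (Finset.ne_of_mem_erase hj)]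

theorem IsLetterSampler.ne_zero_of_prob_ne_zero (hD : IsLetterSampler D) {n : Fin k → ℕ}
    (hn : n ≠ 0) {i : Fin k} (hi : (D n).prob i ≠ 0) : n i ≠ 0 := by
  intro h; rw [hD n hn, h] at hi; simp at hi

/-- Each draw of `a` contributes the current `n a` over the current total; along a word of type `n`
these factors multiply to factorials, independently of the order. -/
theorem prob_drawWord (hD : IsLetterSampler D) {m : ℕ} {n : Fin k → ℕ} (hm : ∑ i, n i = m)
    (w : List (Fin k)) : (drawWord D m n).prob w =
      if ∀ i, w.count i = n i then ((∏ i, (n i).factorial : ℕ) : ℝ≥0∞) / (m.factorial : ℕ)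
      else 0 := by
  induction m generalizing n w with
  | zero =>
    have hn : ∀ i, n i = 0 := fun i => (Finset.sum_eq_zero_iff.1 hm) i (Finset.mem_univ i)
    rw [drawWord, prob_ofOption_some]
    have : (∀ i, w.count i = n i) ↔ [] = w := by
      simp only [hn, List.count_eq_zero]
      constructor
      · intro h; exact (List.eq_nil_iff_forall_not_mem.2 h).symm
      · rintro rfl; simp
    by_cases h : ∀ i, w.count i = n i
    · rw [if_pos h, if_pos (this.1 h)]
      simp [hn]
    · rw [if_neg h, if_neg (mt this.2 h)]
  | succ m ih =>
    have hn := ne_zero_of_sum_eq_succ hm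
    rw [drawWord, prob_bind]
    simp only [prob_bind, prob_ofOption_some]
    rcases w with _ | ⟨a, w⟩
    · rw [if_neg]
      · simp [expect]
      · intro h
        exact hn (funext fun i => (h i).symm)
    · have hin : ∀ i, (expect (drawWord D m (n - Pi.single i 1)) fun w' =>
          if i :: w' = a :: w then 1 else 0) =
          if i = a then (drawWord D m (n - Pi.single a 1)).prob w else 0 := by
        intro i
        by_cases hia : i = a
        · subst hia; simp [expect]
        · simp [expect, hia]
      simp only [hin]
      have hout : (D n).expect (fun i => if i = a then (drawWord D m (n - Pi.single a 1)).prob w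
          else 0) = (D n).prob a * (drawWord D m (n - Pi.single a 1)).prob w := by
        simp [expect]
      rw [hout]
      by_cases ha : n a = 0
      · rw [hD n hn, ha, if_neg]
        · simp
        · intro h
          have := h a
          rw [ha] at this; simp at this
      · rw [ih (sum_sub_single hm ha), hD n hn, hm]
        have hiff : (∀ i, w.count i = (n - Pi.single a 1 : Fin k → ℕ) i) ↔ ∀ i, (a :: w).count i = n i := by
          refine forall_congr' fun i => ?_
          rw [List.count_cons]
          by_cases hia : i = a
          · subst hia; simp; omega
          · simp [hia, Ne.symm hia]
        by_cases h : ∀ i, (a :: w).count i = n i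
        · rw [if_pos h, if_pos (hiff.2 h), prod_factorial_eq ha, Nat.factorial_succ, Nat.cast_mul, Nat.cast_mul,
            ENNReal.mul_div_mul_comm (.inr (ENNReal.natCast_ne_top _))
              (.inl (ENNReal.natCast_ne_top _))]
        · rw [if_neg h, if_neg (mt hiff.1 h), mul_zero]

theorem tsum_prob_drawWord (hD : IsLetterSampler D) {m : ℕ} {n : Fin k → ℕ}
    (hm : ∑ i, n i = m) : ∑' w, (drawWord D m n).prob w = 1 := by
  induction m generalizing n with
  | zero => exact tsum_prob_ofOption_some _
  | succ m ih =>
    have hn := ne_zero_of_sum_eq_succ hm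
    rw [drawWord, tsum_prob_bind, expect_congr (h' := fun _ => 1), expect_const, mul_one,
      tsum_fintype, hD.sum_prob hn]
    intro i hi
    rw [tsum_prob_bind]
    simp only [tsum_prob_ofOption_some]
    rw [expect_const, mul_one, ih (sum_sub_single hm (hD.ne_zero_of_prob_ne_zero hn hi))]

theorem cost_drawWord_succ (D : (Fin k → ℕ) → BitSampler (Fin k)) (m : ℕ) (n : Fin k → ℕ) :
    (drawWord D (m + 1) n).cost =
      (D n).cost + (D n).expect fun i => (drawWord D m (n - Pi.single i 1)).cost := by
  rw [drawWord, cost_bind]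
  simp only [cost_bind, cost_ofOption_some, expect_const, mul_zero, add_zero]

theorem cost_drawWord_le (hD : IsLetterSampler D) {B : ℝ≥0∞} (hB : ∀ n ≠ 0, (D n).cost ≤ B)
    {m : ℕ} {n : Fin k → ℕ} (hm : ∑ i, n i = m) : (drawWord D m n).cost ≤ B * m := by
  induction m generalizing n with
  | zero => exact (cost_ofOption_some _).trans_le zero_le
  | succ m ih =>
    have hn := ne_zero_of_sum_eq_succ hm
    rw [cost_drawWord_succ, Nat.cast_succ, mul_add, mul_one, add_comm]
    gcongr
    · refine (expect_mono (h' := fun _ => B * m) _ fun i hi => ?_).trans ?_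
      · exact ih (sum_sub_single hm (hD.ne_zero_of_prob_ne_zero hn hi))
      · rw [expect_const, tsum_fintype, hD.sum_prob hn, one_mul]
    · exact hB n hn

/-- Exact samplers visit the successive tuples with the same law, so comparing the draws one at a
time suffices. -/
theorem cost_drawWord_mono (hD : IsLetterSampler D) (hD' : IsLetterSampler D')
    (h : ∀ n ≠ 0, (D n).cost ≤ (D' n).cost) {m : ℕ} {n : Fin k → ℕ} (hm : ∑ i, n i = m) :
    (drawWord D m n).cost ≤ (drawWord D' m n).cost := by
  induction m generalizing n with
  | zero => exact le_rfl
  | succ m ih =>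
    have hn := ne_zero_of_sum_eq_succ hm
    rw [cost_drawWord_succ, cost_drawWord_succ]
    gcongr
    · exact h n hn
    · have heq : ∀ h, (D' n).expect h = (D n).expect h := by
        intro h; simp only [expect, hD n hn, hD' n hn]
      rw [heq]
      exact expect_mono _ fun i hi => ih (sum_sub_single hm (hD.ne_zero_of_prob_ne_zero hn hi))

end DrawWord

/-! ### Prefix codes and the cycle lemma -/

theorem List.length_eq_sum_count {k : ℕ} (w : List (Fin k)) : w.length = ∑ i, w.count i := by
  induction w with
  | nil => simp
  | cons a w ih => simp [ih, List.count_cons, Finset.sum_add_distrib]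

namespace TreeAlphabet

variable {k : ℕ} [NeZero k] (A : TreeAlphabet k)

/-- `f(w_1) + ⋯ + f(w_n)` for a word `w` of length `n`. -/
def weight (w : List (Fin k)) : ℤ := (w.map A.f).sum

/-- The prefix code of a tree. -/
def code : A.Tree → List (Fin k)
  | WType.mk a c => a :: (List.ofFn fun j => code (c j)).flatten

/-- All nonempty suffixes of `w` have negative weight. -/
def NegSuffixes (w : List (Fin k)) : Prop := ∀ l < w.length, A.weight (w.drop l) ≤ -1

@[simp] theorem weight_nil : A.weight [] = 0 := rfl

@[simp] theorem weight_cons (a : Fin k) (w : List (Fin k)) :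
    A.weight (a :: w) = A.f a + A.weight w := by simp [weight]

@[simp] theorem weight_append (v w : List (Fin k)) :
    A.weight (v ++ w) = A.weight v + A.weight w := by simp [weight]

theorem weight_eq_sum_count (w : List (Fin k)) :
    A.weight w = ∑ i, (w.count i : ℤ) * A.f i := by
  induction w with
  | nil => simp
  | cons a w ih =>
    simp only [weight_cons, ih, List.count_cons, Nat.cast_add, add_mul, Finset.sum_add_distrib]
    rw [add_comm]
    simp

theorem arity_eq (a : Fin k) : (A.arity a : ℤ) = A.f a + 1 := by
  have := A.neg_one_le a
  rw [arity]; omega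

theorem code_mk (a : Fin k) (c : Fin (A.arity a) → A.Tree) :
    A.code (WType.mk a c) = a :: (List.ofFn c).flatMap A.code := by
  rw [code, List.flatMap, List.map_ofFn]; rfl

theorem count_code (i : Fin k) (T : A.Tree) : (A.code T).count i = A.count i T := by
  induction T with
  | mk a c ih =>
    rw [code, count, List.count_cons, List.count_flatten, List.map_ofFn, List.sum_ofFn, add_comm]
    simp [ih]

theorem forest_flatMap_append {l : List A.Tree}
    (hl : ∀ T ∈ l, ∀ w, A.forest (A.code T ++ w) = T :: A.forest w) (w : List (Fin k)) :
    A.forest (l.flatMap A.code ++ w) = l ++ A.forest w := by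
  induction l with
  | nil => rfl
  | cons T l ih =>
    rw [List.flatMap_cons, List.append_assoc, hl T List.mem_cons_self,
      ih fun T' h => hl T' (List.mem_cons_of_mem _ h)]
    rfl

theorem forest_cons_of_eq_append {a : Fin k} {w : List (Fin k)} {c : Fin (A.arity a) → A.Tree}
    {l : List A.Tree} (h : A.forest w = List.ofFn c ++ l) :
    A.forest (a :: w) = WType.mk a c :: l := by
  have hle : A.arity a ≤ (A.forest w).length := by simp [h]
  rw [forest, dif_pos hle]
  congr 1
  · congr 1
    funext j
    simp only [h]
    rw [List.getElem_append_left (by simp)]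
    simp
  · rw [h, List.drop_left' (by simp)]

/-- The trailing word `w` is what carries the induction through the sons, whose codes are followed
by those of their siblings. -/
theorem forest_code_append (T : A.Tree) (w : List (Fin k)) :
    A.forest (A.code T ++ w) = T :: A.forest w := by
  induction T generalizing w with
  | mk a c ih =>
    rw [code_mk, List.cons_append]
    refine A.forest_cons_of_eq_append (A.forest_flatMap_append (fun T hT w => ?_) w)
    obtain ⟨j, rfl⟩ := (List.mem_ofFn' _ _).1 hT
    exact ih j w

theorem toTree_code (T : A.Tree) : A.toTree (A.code T) = some T := by
  have h := A.forest_code_append T []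
  rw [List.append_nil] at h
  rw [toTree, h]; rfl

theorem code_injective : Function.Injective A.code := fun T T' h => by
  have := A.toTree_code T
  rw [h, toTree_code] at this
  exact (Option.some.inj this).symm

theorem negSuffixes_nil : A.NegSuffixes [] := fun l hl => by simp at hl

theorem negSuffixes_cons {a : Fin k} {w : List (Fin k)} :
    A.NegSuffixes (a :: w) ↔ A.weight (a :: w) ≤ -1 ∧ A.NegSuffixes w := by
  constructor
  · intro h
    refine ⟨h 0 (by simp), fun l hl => h (l + 1) (by simpa using hl)⟩
  · rintro ⟨h1, h2⟩ (_ | l) hl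
    · exact h1
    · exact h2 l (by simpa using hl)

variable {A} in
theorem NegSuffixes.weight_nonpos {w : List (Fin k)} (h : A.NegSuffixes w) : A.weight w ≤ 0 := by
  rcases w with _ | ⟨a, w⟩
  · simp
  · have := (A.negSuffixes_cons.1 h).1
    omega

variable {A} in
-- Decoding goes from right to left: minus the weight of a suffix is the number of trees available,
-- and the sign condition at `a` says exactly that `f(a) + 1` of them exist.
theorem NegSuffixes.exists_eq_flatMap {w : List (Fin k)} (h : A.NegSuffixes w) :
    ∃ l : List A.Tree, w = l.flatMap A.code ∧ (l.length : ℤ) = -A.weight w := by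
  induction w with
  | nil => exact ⟨[], rfl, rfl⟩
  | cons a w ih =>
    obtain ⟨h1, h2⟩ := A.negSuffixes_cons.1 h
    obtain ⟨l, hw, hl⟩ := ih h2
    rw [weight_cons] at h1
    have ha := A.arity_eq a
    have hle : A.arity a ≤ l.length := by omega
    refine ⟨WType.mk a (fun j => l[j.1]'(j.2.trans_le hle)) :: l.drop (A.arity a), ?_, ?_⟩
    · rw [List.flatMap_cons, code_mk, List.cons_append, ← List.flatMap_append]
      congr 1
      have : List.ofFn (fun j : Fin (A.arity a) => l[j.1]'(j.2.trans_le hle)) =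
          l.take (A.arity a) := by
        refine List.ext_getElem (by simp [hle]) fun j h1 h2 => by simp
      rw [this, List.take_append_drop, hw]
    · rw [List.length_cons, List.length_drop, weight_cons]
      push_cast [hle]
      omega

theorem negSuffixes_flatMap_append {l : List A.Tree}
    (hl : ∀ T ∈ l, A.weight (A.code T) = -1 ∧
      ∀ w, A.NegSuffixes w → A.NegSuffixes (A.code T ++ w)) :
    A.weight (l.flatMap A.code) = -l.length ∧
      ∀ w, A.NegSuffixes w → A.NegSuffixes (l.flatMap A.code ++ w) := by
  induction l with
  | nil => exact ⟨rfl, fun w h => h⟩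
  | cons T l ih =>
    obtain ⟨h1, h2⟩ := hl T List.mem_cons_self
    obtain ⟨h3, h4⟩ := ih fun T' h => hl T' (List.mem_cons_of_mem _ h)
    refine ⟨?_, fun w hw => ?_⟩
    · rw [List.flatMap_cons, weight_append, h1, h3, List.length_cons]
      push_cast; ring
    · rw [List.flatMap_cons, List.append_assoc]
      exact h2 _ (h4 w hw)

theorem weight_code_and_negSuffixes (T : A.Tree) : A.weight (A.code T) = -1 ∧
    ∀ w, A.NegSuffixes w → A.NegSuffixes (A.code T ++ w) := by
  induction T with
  | mk a c ih =>
    obtain ⟨h1, h2⟩ := A.negSuffixes_flatMap_append (l := List.ofFn c) (by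
      intro T hT
      obtain ⟨j, rfl⟩ := (List.mem_ofFn' _ _).1 hT
      exact ih j)
    rw [List.length_ofFn, arity_eq] at h1
    rw [code_mk]
    refine ⟨by rw [weight_cons, h1]; ring, fun w hw => ?_⟩
    rw [List.cons_append, negSuffixes_cons]
    refine ⟨?_, h2 w hw⟩
    have := hw.weight_nonpos
    rw [weight_cons, weight_append, h1]
    omega

theorem weight_code (T : A.Tree) : A.weight (A.code T) = -1 := (A.weight_code_and_negSuffixes T).1

theorem negSuffixes_code (T : A.Tree) : A.NegSuffixes (A.code T) := by
  simpa using (A.weight_code_and_negSuffixes T).2 [] A.negSuffixes_nil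

variable {A} in
theorem NegSuffixes.exists_eq_code {w : List (Fin k)} (h : A.NegSuffixes w)
    (hw : A.weight w = -1) : ∃ T, w = A.code T := by
  obtain ⟨l, h1, h2⟩ := h.exists_eq_flatMap
  rw [hw] at h2
  obtain ⟨T, rfl⟩ := List.length_eq_one_iff.1 (by omega : l.length = 1)
  exact ⟨T, by simpa using h1⟩

variable {A} in
-- The two pieces `u.drop l` and `u.take l` would be nonempty suffixes of `u` and of its rotation,
-- each of weight at most -1, although their total is -1.
theorem NegSuffixes.not_rotate {u : List (Fin k)} (h : A.NegSuffixes u) (hu : A.weight u = -1)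
    {l : ℕ} (h0 : 0 < l) (hl : l < u.length) : ¬ A.NegSuffixes (u.rotate l) := by
  intro h'
  have h1 := h l hl
  have h2 := h' (u.length - l) (by rw [List.length_rotate]; omega)
  rw [List.rotate_eq_drop_append_take hl.le, List.drop_left' (by simp)] at h2
  rw [← List.take_append_drop l u, weight_append] at hu
  omega

theorem cutIndex_spec {w : List (Fin k)} (hw : w ≠ []) :
    1 ≤ A.cutIndex w ∧ A.cutIndex w ≤ w.length ∧
      (∀ l, 1 ≤ l → l ≤ w.length → A.height w (A.cutIndex w) ≤ A.height w l) ∧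
      ∀ l, 1 ≤ l → l < A.cutIndex w → A.height w (A.cutIndex w) < A.height w l := by
  have hlen := List.length_pos_of_ne_nil hw
  -- A minimizer exists, so the search succeeds and the default value 0 is never used.
  obtain ⟨y, hy, hmin⟩ := Finset.exists_min_image (Finset.Icc 1 w.length) (A.height w)
    ⟨1, Finset.mem_Icc.2 ⟨le_rfl, hlen⟩⟩
  have hmem : ∀ l, l ∈ List.range' 1 w.length ↔ 1 ≤ l ∧ l ≤ w.length := by
    intro l; rw [List.mem_range'_1]; omega
  simp only [Finset.mem_Icc] at hy hmin
  obtain ⟨x, h1, h2, h3⟩ := List.exists_find?_eq_some_of_pairwise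
    (p := fun l => (List.range' 1 w.length).all fun l' => A.height w l ≤ A.height w l')
    (List.pairwise_lt_range' (s := 1) (n := w.length)) ((hmem y).2 hy)
    (by simp only [List.all_eq_true, hmem, decide_eq_true_eq]; exact hmin)
  have hx : A.cutIndex w = x := by rw [cutIndex, h1, Option.getD_some]
  have hx' := (hmem x).1 (List.mem_of_find?_eq_some h1)
  simp only [List.all_eq_true, hmem, decide_eq_true_eq] at h2 h3
  rw [hx]
  refine ⟨hx'.1, hx'.2, fun l hl hl' => h2 l ⟨hl, hl'⟩, fun l hl hlx => ?_⟩
  by_contra! hle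
  have := h3 l ⟨hl, hlx.le.trans hx'.2⟩ fun l' hl' => hle.trans (h2 l' hl')
  omega

/-- A suffix beginning before the seam has weight `-1 - h(l + j) + h(l)`, which is at most -1 by
minimality. One beginning after it, at `i`, has weight `h(l) - h(i)`, which is negative because `l`
is the first minimizer. -/
theorem negSuffixes_toLukasiewicz {w : List (Fin k)} (hw : A.weight w = -1) :
    A.NegSuffixes (A.toLukasiewicz w) := by
  have hne : w ≠ [] := by rintro rfl; simp at hw
  obtain ⟨h1, h2, h3, h4⟩ := A.cutIndex_spec hne
  rw [toLukasiewicz]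
  set l := A.cutIndex w
  have hdrop : ∀ j, A.height w j + A.weight (w.drop j) = -1 := by
    intro j
    rw [height, ← weight, ← weight_append, List.take_append_drop, hw]
  intro j hj
  rw [List.length_rotate] at hj
  rw [List.rotate_eq_drop_append_take h2]
  rcases lt_or_ge j (w.length - l) with hlt | hge
  · rw [List.drop_append_of_le_length (by rw [List.length_drop]; omega), List.drop_drop,
      weight_append]
    have h5 := h3 (l + j) (by omega) (by omega)
    have h6 := hdrop (l + j)
    rw [height, ← weight] at h5
    omega
  · obtain ⟨i, rfl⟩ := Nat.exists_eq_add_of_le hge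
    have hi : i < l := by omega
    rw [List.drop_append, List.drop_eq_nil_of_le (by rw [List.length_drop]; omega),
      List.nil_append, List.length_drop, Nat.add_sub_cancel_left]
    have h5 : A.height w i + A.weight ((w.take l).drop i) = A.height w l := by
      have : w.take i = (w.take l).take i := by rw [List.take_take, min_eq_left hi.le]
      rw [height, ← weight, this, ← weight_append, List.take_append_drop]; rfl
    -- Index 0 is not a competitor in the minimization; there the bound comes from the full word, of
    -- height -1.
    rcases Nat.eq_zero_or_pos i with rfl | hpos
    · have h6 := h3 w.length (by omega) le_rfl
      have h7 := hdrop w.length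
      rw [List.drop_length, weight_nil] at h7
      have h8 : A.height w 0 = 0 := by simp [height]
      omega
    · have := h4 i hpos hi
      omega

theorem weight_toLukasiewicz (w : List (Fin k)) :
    A.weight (A.toLukasiewicz w) = A.weight w :=
  ((List.rotate_perm w _).map A.f).sum_eq

theorem exists_toLukasiewicz_eq_code {w : List (Fin k)} (hw : A.weight w = -1) :
    ∃ T, A.toLukasiewicz w = A.code T :=
  (A.negSuffixes_toLukasiewicz hw).exists_eq_code (by rw [weight_toLukasiewicz, hw])

theorem length_code_pos (T : A.Tree) : 0 < (A.code T).length := by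
  rcases T with ⟨a, c⟩
  simp [code_mk]

theorem rotate_code_eq {T : A.Tree} {j : ℕ} (h : A.NegSuffixes ((A.code T).rotate j)) :
    (A.code T).rotate j = A.code T := by
  rw [← List.rotate_mod] at h ⊢
  rcases Nat.eq_zero_or_pos (j % (A.code T).length) with h0 | h0
  · rw [h0, List.rotate_zero]
  · exact absurd h ((A.negSuffixes_code T).not_rotate (A.weight_code T) h0
      (Nat.mod_lt _ (A.length_code_pos T)))

theorem toLukasiewicz_eq_code_iff {T : A.Tree} {w : List (Fin k)} :
    A.toLukasiewicz w = A.code T ↔ ∃ j < (A.code T).length, (A.code T).rotate j = w := by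
  constructor
  · intro h
    have hw : A.weight w = -1 := by rw [← weight_toLukasiewicz, h, weight_code]
    obtain ⟨h1, h2, -⟩ := A.cutIndex_spec (w := w) (by rintro rfl; simp at hw)
    have hlen : (A.code T).length = w.length := by rw [← h, toLukasiewicz, List.length_rotate]
    refine ⟨w.length - A.cutIndex w, by omega, ?_⟩
    rw [← h, toLukasiewicz, List.rotate_rotate, Nat.add_sub_cancel' h2, List.rotate_length]
  · rintro ⟨j, -, rfl⟩
    have hw : A.weight ((A.code T).rotate j) = -1 := by
      rw [← A.weight_code T]
      exact ((List.rotate_perm _ _).map A.f).sum_eq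
    have h := A.negSuffixes_toLukasiewicz hw
    rw [toLukasiewicz, List.rotate_rotate] at h ⊢
    exact A.rotate_code_eq h

/-- Two equal rotations would make the code a proper rotation of itself, against
`NegSuffixes.not_rotate`. -/
theorem rotate_code_injOn (T : A.Tree) :
    Set.InjOn (A.code T).rotate (Finset.range (A.code T).length) := by
  have key : ∀ i j, i < j → j < (A.code T).length →
      (A.code T).rotate i ≠ (A.code T).rotate j := by
    intro i j hij hj h
    have h' := congrArg (fun v => v.rotate ((A.code T).length - i)) h
    simp only [List.rotate_rotate] at h'
    rw [Nat.add_sub_cancel' (by omega), List.rotate_length,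
      show j + ((A.code T).length - i) = (A.code T).length + (j - i) by omega,
      ← List.rotate_rotate, List.rotate_length] at h'
    exact (A.negSuffixes_code T).not_rotate (A.weight_code T) (l := j - i) (by omega) (by omega)
      (h' ▸ A.negSuffixes_code T)
  intro i hi j hj h
  simp only [Finset.coe_range, Set.mem_Iio] at hi hj
  rcases lt_trichotomy i j with hlt | heq | hlt
  · exact absurd h (key i j hlt hj)
  · exact heq
  · exact absurd h.symm (key j i hlt hi)

variable {A} in
theorem Valid.weight_eq {n : Fin k → ℕ} (hn : A.Valid n) {w : List (Fin k)}
    (hw : ∀ i, w.count i = n i) : A.weight w = -1 := by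
  rw [weight_eq_sum_count, ← hn]
  exact Finset.sum_congr rfl fun i _ => by rw [hw]

theorem count_eq_of_toLukasiewicz_eq {w : List (Fin k)} {T : A.Tree}
    (h : A.toLukasiewicz w = A.code T) (i : Fin k) : A.count i T = w.count i := by
  rw [← count_code, ← h, toLukasiewicz]
  exact (List.rotate_perm w _).count_eq i

/-! ### Uniformity of the tree sampler -/

open BitSampler

variable {D : (Fin k → ℕ) → BitSampler (Fin k)}

variable {A} in
theorem Valid.exists_toTree_eq {n : Fin k → ℕ} (hn : A.Valid n) (hD : IsLetterSampler D)
    {w : List (Fin k)} (hw : (drawWord D (∑ i, n i) n).prob w ≠ 0) :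
    ∃ T ∈ A.treesOfType n, A.toLukasiewicz w = A.code T := by
  have hw' : ∀ i, w.count i = n i := by
    by_contra h
    rw [prob_drawWord hD rfl, if_neg h] at hw
    exact hw rfl
  obtain ⟨T, hT⟩ := A.exists_toLukasiewicz_eq_code (hn.weight_eq hw')
  exact ⟨T, fun i => by rw [A.count_eq_of_toLukasiewicz_eq hT, hw'], hT⟩

variable {A} in
-- A word that failed to decode would make the sampler run forever; every word of positive
-- probability does decode, at no cost.
theorem Valid.cost_treeSampler {n : Fin k → ℕ} (hn : A.Valid n) (hD : IsLetterSampler D) :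
    (A.treeSampler D n).cost = (drawWord D (∑ i, n i) n).cost := by
  rw [treeSampler, cost_bind, expect_congr (h' := fun _ => 0), expect_const, mul_zero, add_zero]
  intro w hw
  obtain ⟨T, -, hT⟩ := hn.exists_toTree_eq hD hw
  rw [hT, toTree_code, cost_ofOption_some]

variable {A} in
open scoped Classical in
theorem Valid.prob_treeSampler {n : Fin k → ℕ} (hn : A.Valid n) (hD : IsLetterSampler D)
    (T : A.Tree) : (A.treeSampler D n).prob T = (drawWord D (∑ i, n i) n).expect
      fun w => if A.toLukasiewicz w = A.code T then 1 else 0 := by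
  rw [treeSampler, prob_bind]
  refine expect_congr _ fun w hw => ?_
  obtain ⟨T', -, hT'⟩ := hn.exists_toTree_eq hD hw
  rw [hT', toTree_code, prob_ofOption_some]
  simp only [A.code_injective.eq_iff]

variable {A} in
-- The words leading to `T` are the rotations of its code, `|n|` in number and equally likely.
theorem Valid.prob_treeSampler_of_mem {n : Fin k → ℕ} (hn : A.Valid n) (hD : IsLetterSampler D)
    {T : A.Tree} (hT : T ∈ A.treesOfType n) : (A.treeSampler D n).prob T =
      (∑ i, n i : ℕ) * (((∏ i, (n i).factorial : ℕ) : ℝ≥0∞) / ((∑ i, n i).factorial : ℕ)) := by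
  classical
  have hlen : (A.code T).length = ∑ i, n i := by
    rw [List.length_eq_sum_count]
    exact Finset.sum_congr rfl fun i _ => by rw [count_code, hT i]
  have hmem : ∀ w, w ∈ (Finset.range (A.code T).length).image (A.code T).rotate ↔
      A.toLukasiewicz w = A.code T := by
    intro w; rw [toLukasiewicz_eq_code_iff]; simp
  rw [hn.prob_treeSampler hD, expect, ← hlen, ← Finset.card_range (A.code T).length,
    ← Finset.card_image_of_injOn (A.rotate_code_injOn T), ← nsmul_eq_mul, ← Finset.sum_const,
    tsum_eq_sum (s := (Finset.range (A.code T).length).image (A.code T).rotate)]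
  · refine Finset.sum_congr rfl fun w hw => ?_
    have hw' := (hmem w).1 hw
    rw [if_pos hw', mul_one, Finset.card_image_of_injOn (A.rotate_code_injOn T), Finset.card_range,
      prob_drawWord hD hlen.symm, if_pos fun i => ?_]
    rw [← A.count_eq_of_toLukasiewicz_eq hw', hT i]
  · intro w hw
    rw [if_neg (mt (hmem w).2 hw), mul_zero]

theorem isTreeSampler_treeSampler (hD : IsLetterSampler D) :
    A.IsTreeSampler (A.treeSampler D) := by
  classical
  intro n hn
  refine ⟨?_, fun T hT => ?_, fun T hT T' hT' => ?_⟩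
  · rw [treeSampler, tsum_prob_bind, expect_congr (h' := fun _ => 1), expect_const, mul_one,
      tsum_prob_drawWord hD rfl]
    intro w hw
    obtain ⟨T, -, hT⟩ := hn.exists_toTree_eq hD hw
    rw [hT, toTree_code, tsum_prob_ofOption_some]
  · rw [hn.prob_treeSampler hD, expect_congr (h' := fun _ => 0), expect_const, mul_zero]
    intro w hw
    obtain ⟨T', hT', h⟩ := hn.exists_toTree_eq hD hw
    rw [if_neg]
    intro h'
    rw [h] at h'
    exact hT (A.code_injective h' ▸ hT')
  · rw [hn.prob_treeSampler_of_mem hD hT, hn.prob_treeSampler_of_mem hD hT']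

end TreeAlphabet

/-! ### Counting trees, and the lower bound on the cost -/

theorem exists_list_count_eq {k : ℕ} (n : Fin k → ℕ) :
    ∃ w : List (Fin k), ∀ i, w.count i = n i := by
  refine ⟨(∑ i, Multiset.replicate (n i) i).toList, fun i => ?_⟩
  rw [← Multiset.coe_count, Multiset.coe_toList, Multiset.count_sum']
  simp [Multiset.count_replicate]

/-- If `i` and `j` both occur at least `r` times, there are at least `2 ^ r` words of type `n`. -/
theorem exists_finset_list_count_eq {k : ℕ} {i j : Fin k} (hij : i ≠ j) (r : ℕ) (n : Fin k → ℕ)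
    (hi : r ≤ n i) (hj : r ≤ n j) :
    ∃ F : Finset (List (Fin k)), F.card = 2 ^ r ∧ ∀ w ∈ F, ∀ l, w.count l = n l := by
  induction r generalizing n with
  | zero =>
    obtain ⟨w, hw⟩ := exists_list_count_eq n
    exact ⟨{w}, by simp, by simpa using hw⟩
  | succ r ih =>
    set n' : Fin k → ℕ := fun l => if l = i ∨ l = j then n l - 1 else n l with hn'
    obtain ⟨F, hF, hw⟩ := ih n' (by simp [hn']; omega) (by simp [hn']; omega)
    have hcount : ∀ w, (∀ l, w.count l = n' l) → ∀ l, (i :: j :: w).count l = n l := by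
      intro w hw l
      simp only [List.count_cons, hw, hn', beq_iff_eq]
      rcases eq_or_ne l i with rfl | hli
      · simp [hij.symm]; omega
      · rcases eq_or_ne l j with rfl | hlj
        · simp [hij]; omega
        · simp [hli, hlj, hli.symm, hlj.symm]
    have hinj : ∀ a b : Fin k, Function.Injective fun w : List (Fin k) => a :: b :: w :=
      fun a b w w' h => by simpa using h
    -- One `i` and one `j` were set aside; prefixing them in either order doubles the family.
    refine ⟨F.image (fun w => i :: j :: w) ∪ F.image (fun w => j :: i :: w), ?_, ?_⟩
    · rw [Finset.card_union_of_disjoint, Finset.card_image_of_injective _ (hinj i j),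
        Finset.card_image_of_injective _ (hinj j i), hF, pow_succ]
      · ring
      · rw [Finset.disjoint_left]
        simp only [Finset.mem_image]
        rintro _ ⟨w, -, rfl⟩ ⟨w', -, h⟩
        exact hij (List.cons.inj h).1.symm
    · simp only [Finset.mem_union, Finset.mem_image]
      rintro _ (⟨w, h, rfl⟩ | ⟨w, h, rfl⟩) l
      · exact hcount w (hw w h) l
      · rw [(List.Perm.swap i j w).count_eq]
        exact hcount w (hw w h) l

theorem exists_sum_le_mul {k : ℕ} [NeZero k] (g : Fin k → ℕ) : ∃ i, ∑ j, g j ≤ k * g i := by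
  obtain ⟨i, -, hi⟩ := Finset.exists_max_image Finset.univ g ⟨0, Finset.mem_univ _⟩
  refine ⟨i, ?_⟩
  simpa using Finset.sum_le_card_nsmul Finset.univ g (g i) hi

theorem exists_log_add_one_le {δ : ℝ} (hδ : 0 < δ) :
    ∃ m₀ : ℕ, ∀ m, m₀ ≤ m → (Nat.log 2 m : ℝ) + 1 ≤ δ * m := by
  have h2 : 0 < Real.log 2 := Real.log_pos (by norm_num)
  have h := (Real.isLittleO_log_id_atTop.comp_tendsto tendsto_natCast_atTop_atTop).def
    (c := δ / 2 * Real.log 2) (by positivity)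
  have h1 : ∀ᶠ m : ℕ in Filter.atTop, 1 ≤ δ / 2 * m := by
    filter_upwards [Filter.eventually_ge_atTop ⌈2 / δ⌉₊] with m hm
    have := Nat.ceil_le.1 hm
    rw [div_le_iff₀ hδ] at this
    linarith
  obtain ⟨m₀, hm₀⟩ := Filter.eventually_atTop.1 (h.and h1)
  refine ⟨m₀, fun m hm => ?_⟩
  obtain ⟨h3, h4⟩ := hm₀ m hm
  simp only [Function.comp_apply, id_eq, Real.norm_eq_abs, Nat.abs_cast] at h3
  have h5 : (Nat.log 2 m : ℝ) ≤ Real.logb 2 m := by exact_mod_cast Real.natLog_le_logb m 2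
  have h6 : Real.logb 2 m ≤ δ / 2 * m := by
    rw [Real.logb, div_le_iff₀ h2]
    calc Real.log m ≤ |Real.log m| := le_abs_self _
      _ ≤ _ := h3
      _ = _ := by ring
  linarith

namespace TreeAlphabet

variable {k : ℕ} [NeZero k] {A : TreeAlphabet k}

open BitSampler

/-- A type with two letters that occur at least `r` times has at least `2 ^ r / |n|` trees. -/
theorem Valid.exists_finset_trees {n : Fin k → ℕ} (hn : A.Valid n) {i j : Fin k} (hij : i ≠ j)
    {r : ℕ} (hi : r ≤ n i) (hj : r ≤ n j) :
    ∃ F : Finset A.Tree, (∀ T ∈ F, T ∈ A.treesOfType n) ∧ 2 ^ r ≤ (∑ i, n i) * F.card := by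
  classical
  obtain ⟨W, hW, hcount⟩ := exists_finset_list_count_eq hij r n hi hj
  have hex : ∀ w ∈ W, ∃ T, A.toLukasiewicz w = A.code T := fun w hw =>
    A.exists_toLukasiewicz_eq_code (hn.weight_eq (hcount w hw))
  obtain ⟨w₀, hw₀⟩ : W.Nonempty := by
    rw [← Finset.card_pos, hW]; positivity
  have : Nonempty A.Tree := ⟨(hex w₀ hw₀).choose⟩
  choose! φ hφ using hex
  refine ⟨W.image φ, ?_, ?_⟩
  · intro T hT
    obtain ⟨w, hw, rfl⟩ := Finset.mem_image.1 hT
    exact fun i => by rw [A.count_eq_of_toLukasiewicz_eq (hφ w hw), hcount w hw]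
  · rw [← hW]
    -- A fibre of `φ` lies among the rotations of a single code, so it has at most `|n|` elements.
    refine Finset.card_le_mul_card_image W _ fun T hT => ?_
    obtain ⟨w, hw, rfl⟩ := Finset.mem_image.1 hT
    have hlen : (A.code (φ w)).length = ∑ i, n i := by
      rw [← hφ w hw, toLukasiewicz, List.length_rotate, List.length_eq_sum_count]
      exact Finset.sum_congr rfl fun i _ => hcount w hw i
    rw [← hlen]
    refine (Finset.card_le_card (t := (Finset.range (A.code (φ w)).length).image
      (A.code (φ w)).rotate) fun v hv => ?_).trans (Finset.card_image_le.trans_eq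
        (Finset.card_range _))
    obtain ⟨hvW, hv⟩ := Finset.mem_filter.1 hv
    obtain ⟨l, hl, h⟩ := A.toLukasiewicz_eq_code_iff.1 (hv ▸ hφ v hvW)
    exact Finset.mem_image.2 ⟨l, Finset.mem_range.2 hl, h⟩

/-- Since `|n| ≤ 2^s` with `s = ⌊log₂ |n|⌋ + 1`, there are at least `2^(r-s)` trees when `r ≥ s`;
otherwise the logarithmic term alone suffices. -/
theorem Valid.le_cost_add_log {n : Fin k → ℕ} (hn : A.Valid n) {i j : Fin k} (hij : i ≠ j)
    {r : ℕ} (hi : r ≤ n i) (hj : r ≤ n j) {t : BitSampler A.Tree}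
    (ht : t.IsUniformOn (A.treesOfType n)) :
    (r : ℝ≥0∞) ≤ t.cost + (Nat.log 2 (∑ i, n i) + 1 : ℕ) := by
  obtain ⟨F, hF, hcard⟩ := hn.exists_finset_trees hij hi hj
  set s := Nat.log 2 (∑ i, n i) + 1
  rcases le_total r s with h | h
  · exact le_add_left (by exact_mod_cast h)
  · obtain ⟨d, rfl⟩ := Nat.exists_eq_add_of_le' h
    have hs : ∑ i, n i ≤ 2 ^ s := (Nat.lt_pow_succ_log_self (by norm_num) _).le
    have hd : 2 ^ d ≤ F.card := by
      have : 2 ^ d * 2 ^ s ≤ F.card * 2 ^ s := by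
        rw [← pow_add]
        exact hcard.trans ((Nat.mul_le_mul_right _ hs).trans_eq (mul_comm _ _))
      exact Nat.le_of_mul_le_mul_right this (by positivity)
    push_cast
    gcongr
    exact ht.le_cost hF hd

/-- A linear number of bits is needed as soon as two letters have frequency at least `δ`. -/
theorem exists_mul_le_cost (A : TreeAlphabet k) {δ : ℝ} (hδ : 0 < δ) {B : ℝ} (hB : 0 ≤ B) :
    ∃ (C : ℝ≥0) (m₀ : ℕ), ∀ n, A.Valid n → m₀ ≤ ∑ i, n i →
      (∃ i j, i ≠ j ∧ δ * ((∑ l, n l : ℕ) : ℝ) ≤ n i ∧ δ * ((∑ l, n l : ℕ) : ℝ) ≤ n j) →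
      ∀ t : BitSampler A.Tree, t.IsUniformOn (A.treesOfType n) →
        ENNReal.ofReal (B * ((∑ i, n i : ℕ) : ℝ)) ≤ C * t.cost := by
  -- Half of `δ m` pays for the logarithmic loss; the other half remains as the bound, whence the
  -- constant `B / (δ / 2)`.
  obtain ⟨m₀, hm₀⟩ := exists_log_add_one_le (half_pos hδ)
  refine ⟨Real.toNNReal (B / (δ / 2)), m₀, fun n hn hm hij t ht => ?_⟩
  obtain ⟨i, j, hij, hi, hj⟩ := hij
  have h1 := hn.le_cost_add_log hij (Nat.ceil_le.2 hi) (Nat.ceil_le.2 hj) ht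
  have h2 := hm₀ _ hm
  set m := ∑ i, n i
  have h3 : ENNReal.ofReal (δ / 2 * m) ≤ t.cost := by
    refine ENNReal.le_of_add_le_add_right (ENNReal.natCast_ne_top (Nat.log 2 m + 1))
      (le_trans ?_ h1)
    rw [← ENNReal.ofReal_natCast, ← ENNReal.ofReal_natCast,
      ← ENNReal.ofReal_add (by positivity) (by positivity)]
    refine ENNReal.ofReal_le_ofReal ?_
    have := Nat.le_ceil (δ * m)
    push_cast
    linarith
  calc ENNReal.ofReal (B * m) = ENNReal.ofReal (B / (δ / 2)) * ENNReal.ofReal (δ / 2 * m) := by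
        rw [← ENNReal.ofReal_mul (by positivity)]
        congr 1
        field_simp
    _ ≤ _ := by
        gcongr
        exact le_rfl

/-! ### Balanced types and worst-case optimality -/

/-- Such a tree is a chain of copies of the only possible unary letter, closed by one leaf. -/
theorem tree_eq_of_count_eq (h1 : ∀ a, A.f a ≤ 0) (h2 : ∀ a b, A.f a = 0 → A.f b = 0 → a = b)
    {T T' : A.Tree} (h : ∀ i, A.count i T = A.count i T') : T = T' := by
  have hleaf : ∀ (a b : Fin k) (c : Fin (A.arity a) → A.Tree) (d : Fin (A.arity b) → A.Tree),
      (∀ i, A.count i (WType.mk a c) = A.count i (WType.mk b d)) → A.f a = -1 → a = b := by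
    intro a b c d h ha
    have hb := h b
    have : A.arity a = 0 := by rw [arity, ha]; rfl
    have : IsEmpty (Fin (A.arity a)) := by rw [this]; infer_instance
    by_contra hab
    simp [count, hab] at hb
    omega
  induction T generalizing T' with
  | mk a c ih =>
    obtain ⟨b, d⟩ := T'
    have hab : a = b := by
      by_cases ha : A.f a = -1
      · exact hleaf a b c d h ha
      by_cases hb : A.f b = -1
      · exact (hleaf b a d c (fun i => (h i).symm) hb).symm
      have ha1 := A.neg_one_le a
      have hb1 := A.neg_one_le b
      have ha2 := h1 a
      have hb2 := h1 b
      exact h2 a b (by omega) (by omega)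
    subst hab
    congr 1
    funext j
    have hsub : Subsingleton (Fin (A.arity a)) := by
      rw [Fin.subsingleton_iff_le_one, arity]
      have := h1 a
      omega
    refine ih j fun i => ?_
    have hi := h i
    simp only [count] at hi
    rwa [Nat.add_left_cancel_iff, Fintype.sum_subsingleton _ j, Fintype.sum_subsingleton _ j] at hi

/-- Removing `∑ v` copies of the weightless letter `i` and adding `v`, of total weight 0, changes
neither the weight nor the total. -/
theorem Valid.exchange {n v : Fin k → ℕ} (hn : A.Valid n) {i : Fin k} (hi : A.f i = 0)
    (hle : ∑ l, v l ≤ n i) (hv : ∑ l, (v l : ℤ) * A.f l = 0) :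
    ∃ n', A.Valid n' ∧ ∑ l, n' l = ∑ l, n l ∧ ∀ l, v l ≤ n' l := by
  set s := ∑ l, v l
  obtain ⟨b, hb⟩ : ∃ b : Fin k → ℕ, ∀ l, n l = b l + if l = i then s else 0 := by
    refine ⟨fun l => n l - if l = i then s else 0, fun l => ?_⟩
    by_cases h : l = i
    · subst h; simp; omega
    · simp [h]
  refine ⟨fun l => b l + v l, ?_, ?_, fun l => Nat.le_add_left _ _⟩
  · rw [Valid] at hn ⊢
    simp only [Nat.cast_add, add_mul, Finset.sum_add_distrib, hv]
    simpa [hb, add_mul, Finset.sum_add_distrib, hi] using hn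
  · simp [hb, Finset.sum_add_distrib, s]

/-- If some type has two trees, then from every valid tuple one gets a valid tuple with the same
total in which two letters have a positive frequency. -/
theorem exists_balanced (A : TreeAlphabet k)
    (hA : ∃ T T' : A.Tree, T ≠ T' ∧ ∀ i, A.count i T = A.count i T') :
    ∃ q : ℕ, 0 < q ∧ ∀ n, A.Valid n → ∃ n', A.Valid n' ∧ ∑ l, n' l = ∑ l, n l ∧
      ∃ i j, i ≠ j ∧ ∑ l, n l ≤ q * (n' i + 1) ∧ ∑ l, n l ≤ q * (n' j + 1) := by
  obtain ⟨F, hF⟩ : ∃ F : ℕ, ∀ i, A.f i ≤ F := by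
    refine ⟨∑ i, (A.f i).natAbs, fun i => ?_⟩
    have := Finset.single_le_sum (fun i _ => Nat.zero_le (A.f i).natAbs) (Finset.mem_univ i)
    omega
  have hk := NeZero.pos k
  -- The total is at most `1 + (F + 1) * k * n i` for the most frequent non-leaf letter `i`; the
  -- factor `k + F + 2` covers the further loss, at most `k`, `F + 1` or 2, of every case below.
  refine ⟨1 + (F + 2) * k * (k + F + 2), by positivity, fun n hn => ?_⟩
  set q := 1 + (F + 2) * k * (k + F + 2)
  set m := ∑ l, n l
  obtain ⟨x, hx⟩ := exists_sum_le_mul fun l => if A.f l = -1 then n l else 0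
  obtain ⟨i, hi⟩ := exists_sum_le_mul fun l => if A.f l = -1 then 0 else n l
  set L := ∑ l, if A.f l = -1 then n l else 0 with hL
  set I := ∑ l, if A.f l = -1 then 0 else n l with hI
  have hm : m = L + I := by
    rw [hL, hI, ← Finset.sum_add_distrib]
    exact Finset.sum_congr rfl fun l _ => by split_ifs <;> simp
  have hval : ∑ l, (if A.f l = -1 then 0 else (n l : ℤ) * A.f l) = L - 1 := by
    have : ∑ l, (if A.f l = -1 then 0 else (n l : ℤ) * A.f l) =
        ∑ l, (n l : ℤ) * A.f l + L := by
      rw [hL, Nat.cast_sum, ← Finset.sum_add_distrib]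
      refine Finset.sum_congr rfl fun l _ => ?_
      split_ifs with h <;> simp [h]
    rw [this, hn]; ring
  -- Validity makes the number of leaves one more than the weight of the other nodes, each of weight
  -- at most `F`.
  have hLI : L ≤ 1 + F * I := by
    have : ∑ l, (if A.f l = -1 then 0 else (n l : ℤ) * A.f l) ≤ F * I := by
      rw [hI, Nat.cast_sum, Finset.mul_sum]
      refine Finset.sum_le_sum fun l _ => ?_
      split_ifs
      · simp
      · rw [mul_comm]; gcongr; exact hF l
    zify; linarith
  have hmI : m ≤ 1 + (F + 1) * I := by rw [hm]; linarith
  have hkind : (∃ p, 1 ≤ A.f p) ∨ ∃ y z, y ≠ z ∧ A.f y = 0 ∧ A.f z = 0 := by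
    by_contra! hcon
    obtain ⟨T, T', hne, hTT'⟩ := hA
    refine hne (tree_eq_of_count_eq (fun a => ?_) (fun a b ha hb => ?_) hTT')
    · have := hcon.1 a; omega
    · by_contra hab; exact hcon.2 a b hab ha hb
  -- Here no internal letter occurs at all, so the total is at most 1 and any two distinct letters
  -- will do.
  by_cases hi1 : A.f i = -1
  · have hI0 : I = 0 := by simpa [hi1] using hi
    have hm1 : m ≤ 1 := by rw [hI0] at hmI; simpa using hmI
    have hbound : ∀ r, m ≤ q * (r + 1) := fun r =>
      hm1.trans (Nat.mul_pos (show 0 < q by positivity) r.succ_pos)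
    obtain ⟨y, z, hyz⟩ : ∃ y z : Fin k, y ≠ z := by
      rcases hkind with ⟨p, hp⟩ | ⟨y, z, hyz, -⟩
      · refine ⟨0, p, ?_⟩
        rintro rfl
        rw [A.first] at hp; omega
      · exact ⟨y, z, hyz⟩
    exact ⟨n, hn, rfl, y, z, hyz, hbound _, hbound _⟩
  simp only [hi1, if_false] at hi
  have hbound : ∀ r, n i ≤ (k + F + 2) * (r + 1) → m ≤ q * (r + 1) := by
    intro r hr
    calc m ≤ 1 + (F + 1) * (k * ((k + F + 2) * (r + 1))) := by
          refine hmI.trans ?_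
          gcongr
          exact hi.trans (Nat.mul_le_mul_left _ hr)
      _ ≤ (r + 1) + (F + 2) * (k * ((k + F + 2) * (r + 1))) := by gcongr <;> omega
      _ = q * (r + 1) := by ring
  have hi0 : 0 ≤ A.f i := by have := A.neg_one_le i; omega
  rcases hi0.eq_or_lt with h0 | hpos
  · rcases hkind with ⟨p, hp⟩ | ⟨y, z, hyz, hy, hz⟩
    · obtain ⟨P, hP⟩ := Int.eq_ofNat_of_zero_le (by omega : 0 ≤ A.f p)
      have hPF : P ≤ F := by have := hF p; omega
      have hP1 : 1 ≤ P := by omega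
      set t := n i / (P + 1)
      have hp0 : (0 : Fin k) ≠ p := by
        rintro rfl
        rw [A.first] at hp; omega
      -- Unary nodes are traded for `t` letters `p` of weight `P` and `P * t` leaves, a mixture of
      -- weight 0.
      obtain ⟨n', h1, h2, h3⟩ := hn.exchange
        (v := fun l => (if l = p then t else 0) + if l = 0 then P * t else 0) h0.symm
        (by
          simp only [Finset.sum_add_distrib, Finset.sum_ite_eq', Finset.mem_univ, if_true]
          exact (show t + P * t = t * (P + 1) by ring).trans_le (Nat.div_mul_le_self _ _))
        (by simp [add_mul, Finset.sum_add_distrib, hP, A.first, mul_comm])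
      have hr : n i ≤ (k + F + 2) * (t + 1) := by
        have h4 := (Nat.lt_div_mul_add (a := n i) (b := P + 1) (by omega)).le
        calc n i ≤ (P + 1) * (t + 1) := h4.trans_eq (by ring)
          _ ≤ _ := Nat.mul_le_mul_right _ (by omega)
      have hmt := hbound t hr
      refine ⟨n', h1, h2, 0, p, hp0, hmt.trans ?_, hmt.trans ?_⟩
      · have h5 := h3 0
        simp only [hp0, if_false, if_true, zero_add] at h5
        gcongr
        nlinarith
      · have h5 := h3 p
        simp only [if_true] at h5
        gcongr
        omega
    · obtain ⟨x, hxi, hx0⟩ : ∃ x, x ≠ i ∧ A.f x = 0 := by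
        by_cases h : y = i
        · exact ⟨z, h ▸ hyz.symm, hz⟩
        · exact ⟨y, h, hy⟩
      set t := n i / 2
      -- With a second unary letter `x`, the copies of `i` are shared between `i` and `x`.
      obtain ⟨n', h1, h2, h3⟩ := hn.exchange
        (v := fun l => (if l = i then t else 0) + if l = x then t else 0) h0.symm
        (by
          simp only [Finset.sum_add_distrib, Finset.sum_ite_eq', Finset.mem_univ, if_true]
          omega)
        (by simp [add_mul, Finset.sum_add_distrib, hx0, ← h0])
      have hr : n i ≤ (k + F + 2) * (t + 1) := by
        calc n i ≤ 2 * (t + 1) := by omega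
          _ ≤ _ := by gcongr; omega
      have hmt := hbound t hr
      refine ⟨n', h1, h2, x, i, hxi, hmt.trans ?_, hmt.trans ?_⟩
      · have h5 := h3 x
        simp only [if_true] at h5
        gcongr
        omega
      · have h5 := h3 i
        simp only [if_true] at h5
        gcongr
        omega
  -- If `f(i) > 0`, each `i` forces at least one leaf, so the most frequent leaf letter `x` is
  -- frequent too and `n` needs no change.
  · have hL1 : n i ≤ L := by
      have hle : (if A.f i = -1 then 0 else (n i : ℤ) * A.f i) ≤ L - 1 := by
        rw [← hval]
        refine Finset.single_le_sum (f := fun l => if A.f l = -1 then 0 else (n l : ℤ) * A.f l)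
          (fun l _ => ?_) (Finset.mem_univ i)
        split_ifs with h
        · rfl
        · have := A.neg_one_le l
          exact mul_nonneg (by positivity) (by omega)
      rw [if_neg hi1] at hle
      have : (n i : ℤ) ≤ n i * A.f i := le_mul_of_one_le_right (by positivity) hpos
      omega
    by_cases hx1 : A.f x = -1
    · simp only [hx1, if_true] at hx
      refine ⟨n, hn, rfl, i, x, ?_, hbound _ ?_, hbound _ ?_⟩
      · rintro rfl; exact hi1 hx1
      · nlinarith
      · calc n i ≤ k * n x := hL1.trans hx
          _ ≤ _ := by gcongr <;> omega
    · exfalso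
      have hL0 : L = 0 := by simpa [hx1] using hx
      have hle : 0 ≤ ∑ l, (if A.f l = -1 then 0 else (n l : ℤ) * A.f l) := by
        refine Finset.sum_nonneg fun l _ => ?_
        split_ifs with h
        · rfl
        · have := A.neg_one_le l
          exact mul_nonneg (by positivity) (by omega)
      rw [hval, hL0] at hle
      omega

/-- The tree sampler is optimal in the worst case, up to a multiplicative constant. -/
theorem exists_complexity_le (A : TreeAlphabet k)
    (hA : ∃ T T' : A.Tree, T ≠ T' ∧ ∀ i, A.count i T = A.count i T') {B : ℝ} (hB : 0 ≤ B)
    {R : (Fin k → ℕ) → BitSampler A.Tree}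
    (hR : ∀ n, A.Valid n → (R n).cost ≤ ENNReal.ofReal (B * ((∑ i, n i : ℕ) : ℝ))) :
    ∃ (C : ℝ≥0) (m₀ : ℕ), ∀ S : (Fin k → ℕ) → BitSampler A.Tree, A.IsTreeSampler S →
      ∀ m, m₀ ≤ m → A.complexity R m ≤ C * A.complexity S m := by
  obtain ⟨q, hq, hbal⟩ := A.exists_balanced hA
  -- For `m ≥ 2q`, the bound `m ≤ q (r + 1)` gives `r ≥ m/q - 1 ≥ m/(2q)`.
  obtain ⟨C, m₀, hC⟩ := A.exists_mul_le_cost (δ := 1 / (2 * q)) (by positivity) hB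
  refine ⟨C, max m₀ (2 * q), fun S hS m hm => iSup₂_le fun n hn => ?_⟩
  obtain ⟨hn, rfl⟩ := hn
  obtain ⟨n', hn', hsum, i, j, hij, hi, hj⟩ := hbal n hn
  have hfreq : ∀ r : ℕ, ∑ l, n l ≤ q * (r + 1) →
      1 / (2 * q) * ((∑ l, n' l : ℕ) : ℝ) ≤ r := by
    intro r hr
    rw [hsum, div_mul_eq_mul_div, one_mul, div_le_iff₀ (by positivity)]
    have h1 : (((∑ l, n l : ℕ) : ℝ)) ≤ q * (r + 1) := by exact_mod_cast hr
    have h2 : (2 * q : ℝ) ≤ ((∑ l, n l : ℕ) : ℝ) := by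
      exact_mod_cast (le_max_right _ _).trans hm
    linarith
  refine (hR n hn).trans ?_
  -- The upper bound depends on the total only, so it may be compared with the cost of `S` at the
  -- balanced type `n'`.
  rw [← hsum]
  refine (hC n' hn' (by rw [hsum]; exact (le_max_left _ _).trans hm)
    ⟨i, j, hij, hfreq _ hi, hfreq _ hj⟩ (S n') (hS n' hn')).trans ?_
  gcongr
  exact le_iSup₂ (f := fun (n : Fin k → ℕ) (_ : A.Valid n ∧ ∑ i, n i = ∑ i, n' i) => (S n).cost)
    n' ⟨hn', rfl⟩

end TreeAlphabet

/-! ### The theorem -/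

theorem mainTheorem5 {k : ℕ} [NeZero k] (A : TreeAlphabet k) :
    (∀ D : (Fin k → ℕ) → BitSampler (Fin k), D = knuthYao ∨ D = dichotomic →
      -- the sampler is exactly uniform
      A.IsTreeSampler (A.treeSampler D) ∧
      -- it uses a linear number of bits in the mean
      (∀ n, A.Valid n → (A.treeSampler D n).cost ≤
        ENNReal.ofReal ((2 + Real.logb 2 k) * ((∑ i, n i : ℕ) : ℝ))) ∧
      -- its complexity is optimal up to a constant, as soon as trees are not determined by their
      -- type
      ((∃ T T' : A.Tree, T ≠ T' ∧ ∀ i, A.count i T = A.count i T') →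
        ∃ (C : ℝ≥0) (m₀ : ℕ), ∀ S : (Fin k → ℕ) → BitSampler A.Tree, A.IsTreeSampler S →
          ∀ m, m₀ ≤ m → A.complexity (A.treeSampler D) m ≤ C * A.complexity S m) ∧
      -- for a given type it is optimal up to a constant when two letters have frequency at
      -- least `δ`
      (∀ δ : ℝ, 0 < δ → ∃ (C : ℝ≥0) (m₀ : ℕ), ∀ n, A.Valid n → m₀ ≤ ∑ i, n i →
        (∃ i j, i ≠ j ∧ δ * ((∑ l, n l : ℕ) : ℝ) ≤ n i ∧ δ * ((∑ l, n l : ℕ) : ℝ) ≤ n j) →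
        ∀ t : BitSampler A.Tree, t.IsUniformOn (A.treesOfType n) →
          (A.treeSampler D n).cost ≤ C * t.cost)) ∧
    -- with the Knuth-Yao sampler no bit is wasted by the draws of the letters
    (∀ D : (Fin k → ℕ) → BitSampler (Fin k), IsLetterSampler D → ∀ n, A.Valid n →
      (A.treeSampler knuthYao n).cost ≤ (A.treeSampler D n).cost) := by
  have hlogb : 0 ≤ 2 + Real.logb 2 k := by
    have := Real.logb_nonneg (b := 2) (by norm_num) (x := k)
      (by exact_mod_cast NeZero.one_le (n := k))
    linarith
  have hopt : ∀ D : (Fin k → ℕ) → BitSampler (Fin k), IsLetterSampler D → ∀ n, A.Valid n →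
      (A.treeSampler knuthYao n).cost ≤ (A.treeSampler D n).cost := by
    intro D hD n hn
    rw [hn.cost_treeSampler isLetterSampler_knuthYao, hn.cost_treeSampler hD]
    exact cost_drawWord_mono isLetterSampler_knuthYao hD (fun _ => cost_knuthYao_le hD) rfl
  refine ⟨fun D hD => ?_, hopt⟩
  have hsampler : IsLetterSampler D := by
    rcases hD with rfl | rfl
    · exact isLetterSampler_knuthYao
    · exact isLetterSampler_dichotomic
  have hcost : ∀ n, A.Valid n → (A.treeSampler D n).cost ≤
      ENNReal.ofReal ((2 + Real.logb 2 k) * ((∑ i, n i : ℕ) : ℝ)) := by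
    have hdich : ∀ n, A.Valid n → (A.treeSampler dichotomic n).cost ≤
        ENNReal.ofReal ((2 + Real.logb 2 k) * ((∑ i, n i : ℕ) : ℝ)) := by
      intro n hn
      rw [hn.cost_treeSampler isLetterSampler_dichotomic, ENNReal.ofReal_mul hlogb,
        ENNReal.ofReal_natCast]
      exact cost_drawWord_le isLetterSampler_dichotomic (fun _ => cost_dichotomic_le) rfl
    -- Knuth-Yao inherits the linear bound from dichotomic sampling through its optimality.
    rcases hD with rfl | rfl
    · exact fun n hn => (hopt _ isLetterSampler_dichotomic n hn).trans (hdich n hn)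
    · exact hdich
  refine ⟨A.isTreeSampler_treeSampler hsampler, hcost,
    fun hA => A.exists_complexity_le hA hlogb hcost, fun δ hδ => ?_⟩
  obtain ⟨C, m₀, hC⟩ := A.exists_mul_le_cost hδ hlogb
  exact ⟨C, m₀, fun n hn hm hij t ht => (hcost n hn).trans (hC n hn hm hij t ht)⟩
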